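/- Let $d\ge 2$ and let $$\phi(z)=\frac{a_0+a_1z+\cdots+a_{d-1}z^{d-1}+a_dz^d}{b_1z+\cdots+b_{d-1}z^{d-1}+b_dz^d}\in\mathbb{Q}_2(z),\qquad a_i,b_j\in\mathbb{Q}_2,\quad a_d=b_d=1,$$ be a rational map of degree $d$ (that is, numerator and denominator have no common factor); put $b_0:=0$. Let $\phi$ act on $\mathbb{P}^1(\mathbb{Q}_2)=\mathbb{Q}_2\cup\{\infty\}$, equipped with the spherical metric $\rho$, given by $\rho(z,w)=\frac{|z-w|_2}{\max\{|z|_2,1\}\max\{|w|_2,1\}}$ and $\rho(z,\infty)=\frac{1}{\max\{|z|_2,1\}}$ for $z,w\in\mathbb{Q}_2$, and $\rho(\infty,\infty)=0$. The map $\phi$ is called *minimal* on $\mathbb{P}^1(\mathbb{Q}_2)$ if every forward orbit is dense, and *$1$-Lipschitz* if $\rho(\phi(P),\phi(Q))\le\rho(P,Q)$ for all $P,Q$. It has *good reduction* if, writing $\phi=f/g$ with $f,g\in\mathbb{Z}_2[z]$ without common factors and with at least one coefficient of $f$ or $g$ of absolute value $1$, the reduction $\overline f/\overline g$ modulo $2$,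 after cancelling common factors, still has degree $d$. Set $$A_\phi=\sum_{0\le i\le d}a_i,\quad B_\phi=\sum_{1\le j\le d}b_j,\quad A_{\phi,1}=\sum_{\substack{0\le i\le d\\ i\equiv1\ (2)}}a_i,\quad A_{\phi,2}=\sum_{\substack{0\le i\le d\\ i\equiv1\ (4)}}a_i,\quad A_{\phi,3}=\sum_{\substack{0\le i\le d\\ i\equiv3\ (4)}}a_i,$$ and consider the system of conditions $$(\ast)\quad\begin{cases} a_i,b_j\in\mathbb{Z}_2\quad\text{for }0\le i\le d-1,\ 1\le j\le d-1,\\ a_0\equiv1\pmod 2,\\ B_\phi\equiv1\pmod 2,\\ A_\phi\equiv2\pmod 4,\\ A_{\phi,1}\equiv1\pmod 2,\\ b_1\equiv1\pmod 2,\\ a_{d-1}-b_{d-1}\equiv1\pmod 2,\\ a_0b_1(a_{d-1}-b_{d-1})(A_{\phi,2}-A_{\phi,3})B_\phi+2\,(b_2-a_1+a_{d-2}-b_{d-2}+b_{d-1}+A_{\phi,3})\equiv1\pmod 4. \end{cases}$$ If $\phi$ has good reduction and is minimal on $\mathbb{P}^1(\mathbb{Q}_2)$, then $(\ast)$ holds.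 Conversely, $(\ast)$ implies that $\phi$ is $1$-Lipschitz and minimal on $\mathbb{P}^1(\mathbb{Q}_2)$. -/

import Mathlib

open Polynomial OnePoint

noncomputable section

namespace PadicDyn

/-- The degree of a rational function: the maximum of the degrees of its numerator and
denominator, written without common factors. -/
def ratDegree {K : Type*} [Field K] (φ : RatFunc K) : ℕ :=
  max φ.num.natDegree φ.denom.natDegree

/-- The transformation of the projective line `ℙ¹(K) = K ∪ {∞}` induced by a rational function
`φ` (`φ.num` and `φ.denom` have no common factors).  At `∞` one compares the coefficients of
`z ^ n` in the numerator and the denominator, where `n` is the degree of `φ`. -/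
def ratMap {K : Type*} [Field K] (φ : RatFunc K) : OnePoint K → OnePoint K
  | ∞ =>
      open Classical in
      if φ.denom.coeff (ratDegree φ) = 0 then ∞
      else ((φ.num.coeff (ratDegree φ) / φ.denom.coeff (ratDegree φ) : K) : OnePoint K)
  | OnePoint.some z =>
      open Classical in
      if φ.denom.eval z = 0 then ∞
      else ((φ.num.eval z / φ.denom.eval z : K) : OnePoint K)

/-- The spherical metric on `ℙ¹(ℚ_p) = ℚ_p ∪ {∞}`. -/
def sphericalDist {p : ℕ} [Fact p.Prime] : OnePoint ℚ_[p] → OnePoint ℚ_[p] → ℝ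
  | ∞, ∞ => 0
  | ∞, OnePoint.some w => 1 / max ‖w‖ 1
  | OnePoint.some z, ∞ => 1 / max ‖z‖ 1
  | OnePoint.some z, OnePoint.some w => ‖z - w‖ / (max ‖z‖ 1 * max ‖w‖ 1)

/-- The transformation `T` of `ℙ¹(ℚ_p)` is `1`-Lipschitz for the spherical metric. -/
def IsOneLipschitz {p : ℕ} [Fact p.Prime] (T : OnePoint ℚ_[p] → OnePoint ℚ_[p]) : Prop :=
  ∀ P Q, sphericalDist (T P) (T Q) ≤ sphericalDist P Q

/-- The system `(ℙ¹(ℚ_p), T)` is minimal: every forward orbit is dense for the spherical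
metric. -/
def IsMinimalSystem {p : ℕ} [Fact p.Prime] (T : OnePoint ℚ_[p] → OnePoint ℚ_[p]) : Prop :=
  ∀ P Q, ∀ ε : ℝ, 0 < ε → ∃ k : ℕ, sphericalDist (T^[k] P) Q < ε

/-- The quotient of two polynomials, as a rational function. -/
def ratQuot {K : Type*} [Field K] (f g : K[X]) : RatFunc K :=
  algebraMap K[X] (RatFunc K) f / algebraMap K[X] (RatFunc K) g

/-- Good reduction: write `φ = f / g` with `f, g ∈ ℤ_p[z]` without common factors and with at
least one coefficient of `f` or `g` of absolute value `1`; then the reduction of `f / g` modulo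
`p`, a rational function over `ℤ / pℤ`, has the same degree as `φ`.  (Such a pair `f, g` is unique
up to a common unit of `ℤ_p`.  If the reduction of `g` is `0`, then the reduction of `φ` is the
constant `∞`, and `ratQuot` returns `0`: the degree is `0` in both readings.) -/
def HasGoodReduction {p : ℕ} [Fact p.Prime] (φ : RatFunc ℚ_[p]) : Prop :=
  ∃ f g : ℤ_[p][X],
    g ≠ 0 ∧
    IsCoprime (f.map PadicInt.Coe.ringHom) (g.map PadicInt.Coe.ringHom) ∧
    (∃ i, ‖f.coeff i‖ = 1 ∨ ‖g.coeff i‖ = 1) ∧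
    φ = ratQuot (f.map PadicInt.Coe.ringHom) (g.map PadicInt.Coe.ringHom) ∧
    ratDegree (ratQuot (f.map PadicInt.toZMod) (g.map PadicInt.toZMod)) = ratDegree φ

/-- `x ≡ y (mod m)` in `ℤ_p`: the difference lies in `m ℤ_p`. -/
def CongMod {p : ℕ} [Fact p.Prime] (m : ℕ) (x y : ℚ_[p]) : Prop :=
  ∃ t : ℤ_[p], x - y = (m : ℚ_[p]) * (t : ℚ_[p])

/-- The rational function
`(a₀ + a₁ z + ⋯ + a_d z ^ d) / (b₁ z + ⋯ + b_d z ^ d)`. -/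
def ratOfCoeffs {K : Type*} [Field K] (d : ℕ) (a b : ℕ → K) : RatFunc K :=
  ratQuot (∑ i ∈ Finset.range (d + 1), C (a i) * X ^ i)
    (∑ j ∈ Finset.Icc 1 d, C (b j) * X ^ j)

/-- The sum of the `a i`, `0 ≤ i ≤ d`. -/
def sumA (d : ℕ) (a : ℕ → ℚ_[2]) : ℚ_[2] := ∑ i ∈ Finset.range (d + 1), a i

/-- The sum of the `b j`, `1 ≤ j ≤ d`. -/
def sumB (d : ℕ) (b : ℕ → ℚ_[2]) : ℚ_[2] := ∑ j ∈ Finset.Icc 1 d, b j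

/-- The sum of the `a i` with `0 ≤ i ≤ d` and `i` odd. -/
def sumA1 (d : ℕ) (a : ℕ → ℚ_[2]) : ℚ_[2] := ∑ i ∈ Finset.range (d + 1) with i % 2 = 1, a i

/-- The sum of the `a i` with `0 ≤ i ≤ d` and `i ≡ 1 (mod 4)`. -/
def sumA2 (d : ℕ) (a : ℕ → ℚ_[2]) : ℚ_[2] := ∑ i ∈ Finset.range (d + 1) with i % 4 = 1, a i

/-- The sum of the `a i` with `0 ≤ i ≤ d` and `i ≡ 3 (mod 4)`. -/
def sumA3 (d : ℕ) (a : ℕ → ℚ_[2]) : ℚ_[2] := ∑ i ∈ Finset.range (d + 1) with i % 4 = 3, a i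

/-- The system of conditions on the coefficients. -/
def CoeffCondition (d : ℕ) (a b : ℕ → ℚ_[2]) : Prop :=
  ((∀ i, i ≤ d - 1 → ‖a i‖ ≤ 1) ∧ (∀ j, 1 ≤ j → j ≤ d - 1 → ‖b j‖ ≤ 1)) ∧
  CongMod 2 (a 0) 1 ∧
  CongMod 2 (sumB d b) 1 ∧
  CongMod 4 (sumA d a) 2 ∧
  CongMod 2 (sumA1 d a) 1 ∧
  CongMod 2 (b 1) 1 ∧
  CongMod 2 (a (d - 1) - b (d - 1)) 1 ∧
  CongMod 4
    (a 0 * b 1 * (a (d - 1) - b (d - 1)) * (sumA2 d a - sumA3 d a) * sumB d b +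
      2 * (b 2 - a 1 + a (d - 2) - b (d - 2) + b (d - 1) + sumA3 d a)) 1

end PadicDyn

end

noncomputable section

namespace PadicDyn

/-! Reduction modulo 2 cuts the projective line into three residue disks, around 0, ∞ and 1, each a
copy of ℤ_2. As b_0 = 0 and a_d = b_d = 1, φ sends 0 to ∞ and ∞ to 1; if a_0 and B are odd and A is
even, it rotates the disks 0 → ∞ → 1 → 0 (`exists_actsCyclically`). Minimality then becomes a
question about the first return map to the disk of 0.

A disk is parametrized through 2x, so Taylor terms of order three and more are negligible: each
transition has increments h(α + 2βh) modulo 4h (`QuadApprox`), and this class is closed under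
composition. For such a map of ℤ_2, density of the orbits amounts to F(0) odd and α + 2β ≡ 1 mod 4.
These two conditions are already forced by density modulo 4 (`QuadApprox.of_dense`), and they
propagate to all levels 2^k (`QuadApprox.iterate_two_pow`).

When the α's are odd, α + 2β is multiplicative modulo 4 (`multiplier_comp`); the product over the
three transitions is the last expression in (∗) (`multiplier_eq`). Odd α's also make every
transition an isometry, whence the Lipschitz property.

Good reduction makes the coefficients integral and excludes common zeros modulo 2
(`HasGoodReduction.exists_unit`). This gives a_0 odd; minimality gives A even
(`two_dvd_eval_one_of_isMinimalSystem`), and then B must be odd. -/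

/-! ### Parity and units in ℤ_2. -/

lemma two_dvd_or_exists_eq_one_add (x : ℤ_[2]) : 2 ∣ x ∨ ∃ e, x = 1 + 2 * e := by
  obtain ⟨n, hn, hx⟩ := PadicInt.exists_mem_range x
  rw [PadicInt.maximalIdeal_eq_span_p, Ideal.mem_span_singleton] at hx
  obtain ⟨e, he⟩ := hx
  push_cast at he
  interval_cases n
  · left; exact ⟨e, by linear_combination he⟩
  · right; exact ⟨e, by push_cast at he; linear_combination he⟩

lemma isUnit_one_add_two_mul (e : ℤ_[2]) : IsUnit (1 + 2 * e) := by
  rw [PadicInt.isUnit_iff]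
  by_contra h
  have h1 : ‖(1 + 2 * e : ℤ_[2])‖ < 1 := lt_of_le_of_ne (PadicInt.norm_le_one _) h
  have h2 : ‖(2 * e : ℤ_[2])‖ < 1 := by
    have := (PadicInt.norm_lt_one_iff_dvd (p := 2) (2 * e)).2 (by push_cast; exact ⟨e, rfl⟩)
    exact this
  have := PadicInt.nonarchimedean (p := 2) (1 + 2 * e) (-(2 * e))
  rw [norm_neg, add_neg_cancel_right] at this
  have := lt_of_le_of_lt this (max_lt h1 h2)
  simp at this

lemma isUnit_iff_exists_eq_one_add {x : ℤ_[2]} : IsUnit x ↔ ∃ e, x = 1 + 2 * e := by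
  refine ⟨fun h => ?_, ?_⟩
  · rcases two_dvd_or_exists_eq_one_add x with h2 | h2
    · have := isUnit_of_dvd_unit h2 h
      have h3 : ‖(2 : ℤ_[2])‖ < 1 := (PadicInt.norm_lt_one_iff_dvd (p := 2) 2).2 (by simp)
      exact absurd (PadicInt.isUnit_iff.1 this) h3.ne
    · exact h2
  · rintro ⟨e, rfl⟩
    exact isUnit_one_add_two_mul e

lemma two_dvd_iff_not_isUnit {x : ℤ_[2]} : 2 ∣ x ↔ ¬ IsUnit x := by
  rw [PadicInt.isUnit_iff]
  have := PadicInt.norm_lt_one_iff_dvd (p := 2) x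
  push_cast at this
  rw [← this]
  exact ⟨fun h => h.ne, fun h => lt_of_le_of_ne (PadicInt.norm_le_one _) h⟩

/-! ### Maps of ℤ_2 that are quadratic modulo 4. -/

/-- `F` is affine up to a quadratic correction, modulo `4`, in the sense of difference
quotients. -/
def QuadApprox (F : ℤ_[2] → ℤ_[2]) (α β : ℤ_[2]) : Prop :=
  ∀ x h, 4 * h ∣ F (x + h) - F x - h * (α + 2 * β * h)

lemma QuadApprox.exists_eq {F : ℤ_[2] → ℤ_[2]} {α β : ℤ_[2]} (hF : QuadApprox F α β)
    (x y : ℤ_[2]) :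
    ∃ s, F y = F x + (y - x) * (α + 2 * β * (y - x) + 4 * s) := by
  obtain ⟨s, hs⟩ := hF x (y - x)
  rw [add_sub_cancel] at hs
  exact ⟨s, by linear_combination hs⟩

/-- The chain rule for second-order jets: insert the increment h(α + 2βh) of `F` into that of `G`
and drop multiples of 4h. -/
lemma QuadApprox.comp {F G : ℤ_[2] → ℤ_[2]} {α β γ δ : ℤ_[2]} (hG : QuadApprox G γ δ)
    (hF : QuadApprox F α β) : QuadApprox (G ∘ F) (α * γ) (β * γ + δ * α ^ 2) := by
  intro x h
  obtain ⟨s, hs⟩ := hF.exists_eq x (x + h)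
  obtain ⟨t, ht⟩ := hG.exists_eq (F x) (F (x + h))
  simp only [Function.comp]
  rw [add_sub_cancel_left] at hs
  rw [show F (x + h) - F x = h * (α + 2 * β * h + 4 * s) by rw [hs]; ring] at ht
  refine ⟨(α + 2 * β * h + 4 * s) * t + s * γ +
    2 * δ * h * s * (2 * α + 4 * β * h + 4 * s) + 2 * δ * h * (α * β * h + β ^ 2 * h ^ 2), ?_⟩
  rw [ht]; ring

/-- Every difference quotient is congruent to α modulo 2, hence a unit. -/
lemma QuadApprox.norm_sub {F : ℤ_[2] → ℤ_[2]} {α β : ℤ_[2]} (hF : QuadApprox F α β)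
    (hα : IsUnit α) (x y : ℤ_[2]) : ‖F x - F y‖ = ‖x - y‖ := by
  obtain ⟨s, hs⟩ := hF.exists_eq y x
  obtain ⟨e, rfl⟩ := isUnit_iff_exists_eq_one_add.1 hα
  have := isUnit_one_add_two_mul (e + β * (x - y) + 2 * s)
  rw [PadicInt.isUnit_iff] at this
  rw [show F x - F y = (x - y) * (1 + 2 * (e + β * (x - y) + 2 * s)) by rw [hs]; ring,
    norm_mul, this, mul_one]

lemma exists_eval_two_mul {R : Type*} [CommRing R] (P : R[X]) :
    ∃ Q : R[X], ∀ x, P.eval (2 * x) =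
      P.coeff 0 + P.coeff 1 * (2 * x) + P.coeff 2 * (2 * x) ^ 2 + 8 * Q.eval x := by
  refine ⟨X ^ 3 * (P.divX.divX.divX).comp (2 * X), fun x => ?_⟩
  have h0 : ∀ (S : R[X]) (y : R), S.eval y = S.divX.eval y * y + S.coeff 0 := fun S y => by
    conv_lhs => rw [← S.divX_mul_X_add]
    simp
  rw [h0 P, h0 P.divX, h0 P.divX.divX]
  simp [coeff_divX]
  ring

lemma exists_eval_two_mul_sub {R : Type*} [CommRing R] (P : R[X]) (x h : R) :
    ∃ s, P.eval (2 * (x + h)) =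
      P.eval (2 * x) + 2 * h * (P.coeff 1 + 2 * P.coeff 2 * h + 4 * s) := by
  obtain ⟨Q, hQ⟩ := exists_eval_two_mul P
  obtain ⟨s, hs⟩ := sub_dvd_eval_sub (x + h) x Q
  rw [add_sub_cancel_left] at hs
  refine ⟨s + P.coeff 2 * x, ?_⟩
  rw [hQ, hQ]
  linear_combination 8 * hs

/-! ### Second-order jets of rescaled fractions. -/

/-- `F x` is one half of the value at `2 x` of the fraction `N / D`. -/
def IsHalfQuot (N D : ℤ_[2][X]) (F : ℤ_[2] → ℤ_[2]) : Prop :=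
  ∀ x, 2 * F x * D.eval (2 * x) = N.eval (2 * x)

lemma isUnit_eval_two_mul {D : ℤ_[2][X]} (hD : IsUnit (D.coeff 0)) (x : ℤ_[2]) :
    IsUnit (D.eval (2 * x)) := by
  obtain ⟨Q, hQ⟩ := exists_eval_two_mul D
  obtain ⟨e, he⟩ := isUnit_iff_exists_eq_one_add.1 hD
  rw [hQ, he, isUnit_iff_exists_eq_one_add]
  exact ⟨e + D.coeff 1 * x + 2 * D.coeff 2 * x ^ 2 + 4 * Q.eval x, by ring⟩

lemma exists_isHalfQuot {N D : ℤ_[2][X]} (hD : IsUnit (D.coeff 0)) (hN : 2 ∣ N.coeff 0) :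
    ∃ F, IsHalfQuot N D F := by
  have : ∀ x, ∃ y, 2 * y * D.eval (2 * x) = N.eval (2 * x) := fun x => by
    obtain ⟨Q, hQ⟩ := exists_eval_two_mul N
    obtain ⟨c, hc⟩ := hN
    obtain ⟨u, hu⟩ := isUnit_eval_two_mul hD x
    refine ⟨(c + N.coeff 1 * x + 2 * N.coeff 2 * x ^ 2 + 4 * Q.eval x) * (u⁻¹ : ℤ_[2]ˣ), ?_⟩
    rw [hQ, hc, ← hu]
    linear_combination (2 * (c + N.coeff 1 * x + 2 * N.coeff 2 * x ^ 2 + 4 * Q.eval x)) *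
      u.inv_mul
  choose F hF using this
  exact ⟨F, hF⟩

/-- The quotient rule. Odd squares are 1 modulo 4, so D(0)² disappears from the derivative; the last
summand of the quadratic coefficient comes from the first-order variation of the denominator. -/
lemma IsHalfQuot.quadApprox {N D : ℤ_[2][X]} {F : ℤ_[2] → ℤ_[2]} (hF : IsHalfQuot N D F)
    (hD : IsUnit (D.coeff 0)) :
    QuadApprox F (N.coeff 1 * D.coeff 0 - N.coeff 0 * D.coeff 1)
      (N.coeff 2 * D.coeff 0 - N.coeff 0 * D.coeff 2 +
        D.coeff 0 * D.coeff 1 * (N.coeff 1 * D.coeff 0 - N.coeff 0 * D.coeff 1)) := by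
  intro x h
  have hu := (isUnit_eval_two_mul hD x).mul (isUnit_eval_two_mul hD (x + h))
  rw [← hu.dvd_mul_right]
  have e1 := hF x
  have e2 := hF (x + h)
  obtain ⟨s, hs⟩ := exists_eval_two_mul_sub D x h
  obtain ⟨s', hs'⟩ := exists_eval_two_mul_sub N x h
  obtain ⟨Q, hQ⟩ := exists_eval_two_mul D
  obtain ⟨Q', hQ'⟩ := exists_eval_two_mul N
  obtain ⟨t, ht⟩ : ∃ t, D.eval (2 * x) = D.coeff 0 + 2 * x * D.coeff 1 + 4 * t :=
    ⟨D.coeff 2 * x ^ 2 + 2 * Q.eval x, by rw [hQ]; ring⟩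
  obtain ⟨t', ht'⟩ : ∃ t, N.eval (2 * x) = N.coeff 0 + 2 * x * N.coeff 1 + 4 * t :=
    ⟨N.coeff 2 * x ^ 2 + 2 * Q'.eval x, by rw [hQ']; ring⟩
  obtain ⟨e, he⟩ := isUnit_iff_exists_eq_one_add.1 hD
  generalize D.eval (2 * (x + h)) = Dy at *
  generalize N.eval (2 * (x + h)) = Ny at *
  generalize D.eval (2 * x) = Dx at *
  generalize N.eval (2 * x) = Nx at *
  generalize D.coeff 0 = D0 at *
  generalize D.coeff 1 = D1 at *
  generalize D.coeff 2 = D2 at *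
  generalize N.coeff 0 = N0 at *
  generalize N.coeff 1 = N1 at *
  generalize N.coeff 2 = N2 at *
  have key : (F (x + h) - F x) * (Dx * Dy) =
      h * ((N1 + 2 * N2 * h + 4 * s') * Dx - Nx * (D1 + 2 * D2 * h + 4 * s)) := by
    apply mul_left_cancel₀ (two_ne_zero (α := ℤ_[2]))
    linear_combination Dx * e2 - Dy * e1 + Dx * hs' - Nx * hs
  -- Modulo 4 the two contributions 2x N1 D1 cancel, so the dependence on x disappears; below, in Dx
  -- Dy, the terms in x add up to a multiple of 4.
  obtain ⟨m, hm⟩ : ∃ m, (N1 + 2 * N2 * h + 4 * s') * Dx - Nx * (D1 + 2 * D2 * h + 4 * s) =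
      N1 * D0 - N0 * D1 + 2 * h * (N2 * D0 - N0 * D2) + 4 * m := by
    refine ⟨s' * Dx - Nx * s + N1 * t - t' * D1 + 2 * N2 * h * t - 2 * D2 * h * t' +
      N2 * h * x * D1 - D2 * h * x * N1, ?_⟩
    subst ht ht'; ring
  obtain ⟨n, hn⟩ : ∃ n, Dx * Dy = 1 + 2 * h * D0 * D1 + 4 * n := by
    refine ⟨e + e ^ 2 + x * D0 * D1 + x ^ 2 * D1 ^ 2 + h * x * D1 ^ 2
      + 2 * t * (D0 + 2 * x * D1) + 4 * t ^ 2 + 2 * t * h * D1 + Dx * h * (D2 * h + 2 * s), ?_⟩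
    subst hs ht he; ring
  rw [sub_mul, key, hm, hn]
  refine ⟨m - h * D0 * D1 * (N1 * D0 - N0 * D1)
    - h ^ 2 * D0 * D1 * (N2 * D0 - N0 * D2 + D0 * D1 * (N1 * D0 - N0 * D1))
    - n * (N1 * D0 - N0 * D1 + 2 * (N2 * D0 - N0 * D2 + D0 * D1 * (N1 * D0 - N0 * D1)) * h), ?_⟩
  ring

/-! ### The minimality criterion on ℤ_2. -/

lemma QuadApprox.iterate {F : ℤ_[2] → ℤ_[2]} {α β : ℤ_[2]} (hF : QuadApprox F α β) (n : ℕ) :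
    ∃ δ, QuadApprox F^[n] (α ^ n) δ := by
  induction n with
  | zero => exact ⟨0, fun x h => by simp⟩
  | succ n ih =>
    obtain ⟨δ, hδ⟩ := ih
    rw [Function.iterate_succ', pow_succ]
    exact ⟨_, hF.comp hδ⟩

/-- Doubling argument: if n = 2^k iterates shift x by h, the next n shift it by h(α^n + 2δh + 4s).
For even h and n, α^n ≡ 1 mod 4, so the total shift is 2h modulo 4h. -/
lemma QuadApprox.iterate_two_pow {F : ℤ_[2] → ℤ_[2]} {α β : ℤ_[2]} (hF : QuadApprox F α β)
    (h0 : IsUnit (F 0)) (hαβ : 4 ∣ α + 2 * β - 1) (k : ℕ) (x : ℤ_[2]) :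
    ∃ e, F^[2 ^ k] x = x + 2 ^ k * (1 + 2 * e) := by
  obtain ⟨e0, he0⟩ := isUnit_iff_exists_eq_one_add.1 h0
  obtain ⟨m, hm⟩ := hαβ
  -- Since x² ≡ x mod 2, αx + 2βx² ≡ (α + 2β)x ≡ x mod 4: modulo 4 the map is a translation by an
  -- odd number.
  have h1 : ∀ x, ∃ t, F x = F 0 + x + 4 * t := fun x => by
    obtain ⟨s, hs⟩ := hF.exists_eq 0 x
    have : ∃ c, 2 * c = x * x - x := by
      rcases two_dvd_or_exists_eq_one_add x with ⟨y, rfl⟩ | ⟨y, rfl⟩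
      · exact ⟨2 * y ^ 2 - y, by ring⟩
      · exact ⟨y + 2 * y ^ 2, by ring⟩
    obtain ⟨c, hc⟩ := this
    refine ⟨x * s + m * x + β * c, ?_⟩
    rw [hs]
    linear_combination x * hm - 2 * β * hc
  -- Doubling needs an even shift, so the levels 2^0 and 2^1 are read off from `h1`.
  rcases k with - | k
  · obtain ⟨t, ht⟩ := h1 x
    exact ⟨e0 + 2 * t, by simp only [pow_zero, Function.iterate_one]; rw [ht, he0]; ring⟩
  · induction k generalizing x with
    | zero =>
      obtain ⟨t, ht⟩ := h1 x
      obtain ⟨t', ht'⟩ := h1 (F x)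
      refine ⟨e0 + t + t', ?_⟩
      simp only [zero_add, pow_one, Function.iterate_succ, Function.iterate_zero, Function.comp,
        id]
      rw [ht', ht, he0]; ring
    | succ k ih =>
      obtain ⟨δ, hδ⟩ := hF.iterate (2 ^ (k + 1))
      obtain ⟨e, he⟩ := ih x
      obtain ⟨s, hs⟩ := hδ.exists_eq x (F^[2 ^ (k + 1)] x)
      obtain ⟨c, hc⟩ : ∃ c, α ^ 2 ^ (k + 1) = 1 + 4 * c := by
        have : α = 1 + 2 * (2 * m - β) := by linear_combination hm
        have : 4 ∣ α ^ 2 - 1 := ⟨(2 * m - β) + (2 * m - β) ^ 2, by rw [this]; ring⟩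
        obtain ⟨c, hc⟩ := this.trans (by
          simpa [← pow_mul, ← pow_succ'] using sub_dvd_pow_sub_pow (α ^ 2) 1 (2 ^ k))
        exact ⟨c, by linear_combination hc⟩
      rw [show 2 ^ (k + 1 + 1) = 2 ^ (k + 1) + 2 ^ (k + 1) by ring, Function.iterate_add_apply,
        hs, hc, he]
      exact ⟨e + (1 + 2 * e) * (c + s) + δ * 2 ^ k * (1 + 2 * e) ^ 2, by ring⟩

/-- The target is reached digit by digit: an error 2^k times an odd number is repaired modulo
2^(k+1) by 2^k further iterates. -/
lemma QuadApprox.exists_iterate_dvd {F : ℤ_[2] → ℤ_[2]} {α β : ℤ_[2]} (hF : QuadApprox F α β)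
    (h0 : IsUnit (F 0)) (hαβ : 4 ∣ α + 2 * β - 1) (x y : ℤ_[2]) (k : ℕ) :
    ∃ n, 2 ^ k ∣ F^[n] x - y := by
  induction k with
  | zero => exact ⟨0, by simp⟩
  | succ k ih =>
    obtain ⟨n, t, ht⟩ := ih
    rcases two_dvd_or_exists_eq_one_add t with ⟨s, rfl⟩ | ⟨s, rfl⟩
    · exact ⟨n, s, by rw [ht]; ring⟩
    · obtain ⟨e, he⟩ := hF.iterate_two_pow h0 hαβ k (F^[n] x)
      refine ⟨2 ^ k + n, 1 + s + e, ?_⟩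
      rw [Function.iterate_add_apply, he]
      linear_combination ht

/-- An affine-quadratic map of `ℤ_2` with an orbit dense modulo `4`. -/
lemma QuadApprox.of_dense {F : ℤ_[2] → ℤ_[2]} {α β : ℤ_[2]} (hF : QuadApprox F α β)
    (h : ∀ y, ∃ n, 4 ∣ F^[n] 0 - y) : IsUnit (F 0) ∧ 4 ∣ α + 2 * β - 1 := by
  let π : ℤ_[2] →+* ZMod (2 ^ 2) := PadicInt.toZModPow 2
  have hπ : ∀ x, π x = 0 ↔ 4 ∣ x := fun x => by
    rw [← RingHom.mem_ker, PadicInt.ker_toZModPow, Ideal.mem_span_singleton]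
    norm_num
  have hπF : ∀ x, π (F x) = π (F 0) + π x * (π α + 2 * π β * π x) := fun x => by
    obtain ⟨s, hs⟩ := hF.exists_eq 0 x
    rw [hs]
    simp only [map_add, map_mul, sub_zero, map_ofNat]
    rw [show (4 : ZMod (2 ^ 2)) = 0 from rfl]
    ring
  -- A finite check of the reduced maps: `2 * c = 2` says that c is odd, and otherwise a proper
  -- invariant set `S` containing 0 obstructs density.
  have hdec : ∀ c α β : ZMod (2 ^ 2), (2 * c = 2 ∧ α + 2 * β = 1) ∨
      ∃ S : Finset (ZMod (2 ^ 2)), (0 ∈ S ∧ ∀ x ∈ S, c + x * (α + 2 * β * x) ∈ S) ∧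
        ∃ y, y ∉ S := by
    decide
  rcases hdec (π (F 0)) (π α) (π β) with ⟨h1, h2⟩ | ⟨S, ⟨h0, hS⟩, y, hy⟩
  · constructor
    · by_contra hu
      obtain ⟨c, hc⟩ := two_dvd_iff_not_isUnit.2 hu
      rw [hc, map_mul, ← mul_assoc, map_ofNat] at h1
      rw [show (2 : ZMod (2 ^ 2)) * 2 = 0 from rfl, zero_mul] at h1
      exact absurd h1 (by decide)
    · rw [← hπ, map_sub, map_add, map_mul, map_ofNat, h2, map_one, sub_self]
  · obtain ⟨y, rfl⟩ := ZMod.ringHom_surjective π y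
    obtain ⟨n, hn⟩ := h y
    have : ∀ n, π (F^[n] 0) ∈ S := fun n => by
      induction n with
      | zero => simpa using h0
      | succ n ih => rw [Function.iterate_succ_apply', hπF]; exact hS _ ih
    rw [← hπ, map_sub, sub_eq_zero] at hn
    exact absurd (hn ▸ this n) hy

/-! ### Homogeneous coordinates and the spherical metric. -/

open Classical in
/-- The point `[x : y]` of the projective line over `ℚ_2`. -/
def projPt (x y : ℤ_[2]) : OnePoint ℚ_[2] :=
  if y = 0 then ∞ else ((x / y : ℚ_[2]) : OnePoint ℚ_[2])

lemma projPt_zero (x : ℤ_[2]) : projPt x 0 = ∞ := if_pos rfl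

lemma projPt_of_ne (x : ℤ_[2]) {y : ℤ_[2]} (hy : y ≠ 0) :
    projPt x y = ((x / y : ℚ_[2]) : OnePoint ℚ_[2]) := if_neg hy

lemma projPt_one (x : ℤ_[2]) : projPt x 1 = ((x : ℚ_[2]) : OnePoint ℚ_[2]) := by
  rw [projPt_of_ne _ one_ne_zero]; simp

lemma projPt_mul_left {c : ℤ_[2]} (hc : c ≠ 0) (x y : ℤ_[2]) :
    projPt (c * x) (c * y) = projPt x y := by
  by_cases hy : y = 0
  · rw [hy, mul_zero, projPt_zero, projPt_zero]
  · rw [projPt_of_ne _ hy, projPt_of_ne _ (mul_ne_zero hc hy)]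
    have : (c : ℚ_[2]) ≠ 0 := by rwa [Ne, PadicInt.coe_eq_zero]
    rw [PadicInt.coe_mul, PadicInt.coe_mul, mul_div_mul_left _ _ this]

lemma max_norm_div_one {x y : ℤ_[2]} (h : IsUnit x ∨ IsUnit y) (hy : y ≠ 0) :
    max ‖(x / y : ℚ_[2])‖ 1 = ‖y‖⁻¹ := by
  have hy' : 0 < ‖y‖ := norm_pos_iff.2 hy
  have : max ‖x‖ ‖y‖ = 1 := by
    rcases h with h | h
    · rw [PadicInt.isUnit_iff.1 h, max_eq_left (PadicInt.norm_le_one _)]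
    · rw [PadicInt.isUnit_iff.1 h, max_eq_right (PadicInt.norm_le_one _)]
  rw [norm_div, PadicInt.padic_norm_e_of_padicInt, PadicInt.padic_norm_e_of_padicInt]
  rw [← div_self hy'.ne', max_div_div_right hy'.le, this, one_div]

/-- In primitive coordinates the metric is the norm of a determinant, which treats ∞ like any other
point. -/
lemma sphericalDist_projPt {x y x' y' : ℤ_[2]} (h : IsUnit x ∨ IsUnit y)
    (h' : IsUnit x' ∨ IsUnit y') :
    sphericalDist (projPt x y) (projPt x' y') = ‖x * y' - x' * y‖ := by
  by_cases hy : y = 0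
  · have hx : ‖x‖ = 1 := by
      rw [← PadicInt.isUnit_iff]
      rcases h with h | h
      · exact h
      · simp [hy] at h
    by_cases hy' : y' = 0
    · rw [hy, hy', projPt_zero, projPt_zero]
      simp [sphericalDist]
    · rw [hy, projPt_zero, projPt_of_ne _ hy']
      simp only [sphericalDist]
      rw [max_norm_div_one h' hy']
      simp [hx]
  · by_cases hy' : y' = 0
    · have hx' : ‖x'‖ = 1 := by
        rw [← PadicInt.isUnit_iff]
        rcases h' with h | h
        · exact h
        · simp [hy'] at h
      rw [hy', projPt_zero, projPt_of_ne _ hy]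
      simp only [sphericalDist]
      rw [max_norm_div_one h hy]
      simp [hx']
    · rw [projPt_of_ne _ hy, projPt_of_ne _ hy']
      simp only [sphericalDist]
      rw [max_norm_div_one h hy, max_norm_div_one h' hy']
      have h1 : (y : ℚ_[2]) ≠ 0 := by rwa [Ne, PadicInt.coe_eq_zero]
      have h2 : (y' : ℚ_[2]) ≠ 0 := by rwa [Ne, PadicInt.coe_eq_zero]
      rw [div_sub_div _ _ h1 h2, norm_div, norm_mul, mul_comm (y : ℚ_[2]) x']
      rw [PadicInt.padic_norm_e_of_padicInt y, PadicInt.padic_norm_e_of_padicInt y',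
        ← PadicInt.padic_norm_e_of_padicInt (x * y' - x' * y)]
      push_cast
      rw [← mul_inv, div_inv_eq_mul, div_mul_cancel₀]
      exact mul_ne_zero (norm_ne_zero_iff.2 hy) (norm_ne_zero_iff.2 hy')

/-! ### The three residue disks. -/

/-- The residue disks of `0`, `∞` and `1`, each parametrized by `ℤ_2`. -/
def chart : Fin 3 → ℤ_[2] → OnePoint ℚ_[2]
  | 0, x => projPt (2 * x) 1
  | 1, x => projPt 1 (2 * x)
  | 2, x => projPt (1 + 2 * x) 1

lemma exists_chart (P : OnePoint ℚ_[2]) : ∃ i x, P = chart i x := by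
  rcases P with - | z
  · exact ⟨1, 0, by simp only [chart, mul_zero, projPt_zero]; rfl⟩
  · change ∃ i x, ((z : ℚ_[2]) : OnePoint ℚ_[2]) = chart i x
    by_cases hz : ‖z‖ ≤ 1
    · obtain ⟨z, rfl⟩ : ∃ y : ℤ_[2], z = y := ⟨⟨z, hz⟩, rfl⟩
      rcases two_dvd_or_exists_eq_one_add z with ⟨x, rfl⟩ | ⟨x, rfl⟩
      · exact ⟨0, x, by rw [chart, projPt_one]⟩
      · exact ⟨2, x, by rw [chart, projPt_one]⟩
    · push Not at hz
      have hz0 : z ≠ 0 := by rintro rfl; simp at hz; linarith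
      have h1 : ‖z⁻¹‖ < 1 := by rw [norm_inv]; exact inv_lt_one_of_one_lt₀ hz
      obtain ⟨w, hw⟩ : ∃ y : ℤ_[2], z⁻¹ = y := ⟨⟨z⁻¹, h1.le⟩, rfl⟩
      rw [hw, PadicInt.padic_norm_e_of_padicInt, PadicInt.norm_lt_one_iff_dvd] at h1
      obtain ⟨x, hx⟩ := h1
      push_cast at hx
      have hw0 : w ≠ 0 := by
        rintro rfl
        simp [hz0] at hw
      refine ⟨1, x, ?_⟩
      rw [chart, ← hx, projPt_of_ne _ hw0, ← hw]
      simp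

lemma sphericalDist_chart (i : Fin 3) (x y : ℤ_[2]) :
    sphericalDist (chart i x) (chart i y) = ‖2 * (x - y)‖ := by
  fin_cases i
  · simp only [chart]
    rw [sphericalDist_projPt (Or.inr isUnit_one) (Or.inr isUnit_one)]
    congr 1; ring
  · simp only [chart]
    rw [sphericalDist_projPt (Or.inl isUnit_one) (Or.inl isUnit_one), ← norm_neg]
    congr 1; ring
  · simp only [chart]
    rw [sphericalDist_projPt (Or.inr isUnit_one) (Or.inr isUnit_one)]
    congr 1; ring

lemma sphericalDist_chart_of_ne {i j : Fin 3} (hij : i ≠ j) (x y : ℤ_[2]) :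
    sphericalDist (chart i x) (chart j y) = 1 := by
  have h2 : ∀ x, IsUnit (1 + 2 * x : ℤ_[2]) := isUnit_one_add_two_mul
  have hu : ∀ z e : ℤ_[2], z = 1 + 2 * e → ‖z‖ = 1 := fun z e h => by
    rw [← PadicInt.isUnit_iff, h]; exact h2 e
  fin_cases i <;> fin_cases j <;> simp only [chart]
    <;> first
      | exact absurd rfl hij
      | rw [sphericalDist_projPt (by simp) (by simp)]
  · exact hu _ (2 * x * y - 1) (by ring)
  · exact hu _ (x - y - 1) (by ring)
  · exact hu _ (- 2 * x * y) (by ring)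
  · exact hu _ (- x * (1 + 2 * y)) (by ring)
  · exact hu _ (x - y) (by ring)
  · exact hu _ (y * (1 + 2 * x) - 1) (by ring)

/-! ### Dynamics of a cyclic permutation of the disks. -/

/-- `T` permutes the three residue disks cyclically, and acts on the parameters by the maps
`F i`. -/
def ActsCyclically (T : OnePoint ℚ_[2] → OnePoint ℚ_[2]) (F : Fin 3 → ℤ_[2] → ℤ_[2]) : Prop :=
  ∀ i x, T (chart i x) = chart (i + 1) (F i x)

/-- The first return map to the residue disk of `0`. -/
def returnMap (F : Fin 3 → ℤ_[2] → ℤ_[2]) : ℤ_[2] → ℤ_[2] := F 2 ∘ F 1 ∘ F 0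

lemma ActsCyclically.iterate_chart_zero {T : OnePoint ℚ_[2] → OnePoint ℚ_[2]}
    {F : Fin 3 → ℤ_[2] → ℤ_[2]} (h : ActsCyclically T F) (n : ℕ) (x : ℤ_[2]) :
    T^[3 * n] (chart 0 x) = chart 0 ((returnMap F)^[n] x) := by
  have h3 : ∀ x, T^[3] (chart 0 x) = chart 0 (returnMap F x) := fun x => by
    simp only [Function.iterate_succ, Function.iterate_zero, Function.comp, id, h 0 _,
      returnMap]
    rw [h, h]; rfl
  rw [Function.iterate_mul]
  induction n generalizing x with
  | zero => rfl
  | succ n ih => rw [Function.iterate_succ_apply, h3, ih, Function.iterate_succ_apply]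

lemma ActsCyclically.sphericalDist_map {T : OnePoint ℚ_[2] → OnePoint ℚ_[2]}
    {F : Fin 3 → ℤ_[2] → ℤ_[2]} (h : ActsCyclically T F)
    (hF : ∀ i x y, ‖F i x - F i y‖ = ‖x - y‖) (P Q : OnePoint ℚ_[2]) :
    sphericalDist (T P) (T Q) = sphericalDist P Q := by
  obtain ⟨i, x, rfl⟩ := exists_chart P
  obtain ⟨j, y, rfl⟩ := exists_chart Q
  rw [h, h]
  by_cases hij : i = j
  · subst hij
    rw [sphericalDist_chart, sphericalDist_chart, norm_mul, norm_mul, hF]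
  · rw [sphericalDist_chart_of_ne hij, sphericalDist_chart_of_ne]
    exact fun h => hij (add_right_cancel h)

lemma ActsCyclically.exists_iterate_mem_chart_zero {T : OnePoint ℚ_[2] → OnePoint ℚ_[2]}
    {F : Fin 3 → ℤ_[2] → ℤ_[2]} (h : ActsCyclically T F) (P : OnePoint ℚ_[2]) :
    ∃ n x, T^[n] P = chart 0 x := by
  obtain ⟨i, x, rfl⟩ := exists_chart P
  fin_cases i
  · exact ⟨0, x, rfl⟩
  · refine ⟨2, F 2 (F 1 x), ?_⟩
    simp only [Function.iterate_succ, Function.iterate_zero, Function.comp, id]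
    rw [h, h]; rfl
  · exact ⟨1, F 2 x, by simp only [Function.iterate_one]; rw [h]; rfl⟩

/-- Source and target are moved forward by the same j steps, which bring the target into the disk of
0. An approximation found there pulls back, because `T` is an isometry. -/
lemma ActsCyclically.isMinimalSystem {T : OnePoint ℚ_[2] → OnePoint ℚ_[2]}
    {F : Fin 3 → ℤ_[2] → ℤ_[2]} (h : ActsCyclically T F)
    (hF : ∀ i x y, ‖F i x - F i y‖ = ‖x - y‖)
    (hdense : ∀ x y k, ∃ n, 2 ^ k ∣ (returnMap F)^[n] x - y) : IsMinimalSystem T := by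
  intro P Q ε hε
  obtain ⟨j, y, hy⟩ := h.exists_iterate_mem_chart_zero Q
  obtain ⟨s, x, hx⟩ := h.exists_iterate_mem_chart_zero (T^[j] P)
  obtain ⟨k, hk⟩ := exists_pow_lt_of_lt_one hε (show (2⁻¹ : ℝ) < 1 by norm_num)
  obtain ⟨n, hn⟩ := hdense x y k
  refine ⟨3 * n + s, ?_⟩
  have hiso : ∀ m P Q, sphericalDist (T^[m] P) (T^[m] Q) = sphericalDist P Q := fun m => by
    induction m with
    | zero => simp
    | succ m ih =>
      intro P Q
      rw [Function.iterate_succ_apply', Function.iterate_succ_apply', h.sphericalDist_map hF, ih]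
  rw [← hiso j, hy, ← Function.iterate_add_apply, add_comm j, Function.iterate_add_apply,
    Function.iterate_add_apply, hx, h.iterate_chart_zero, sphericalDist_chart]
  refine lt_of_le_of_lt ?_ hk
  obtain ⟨c, hc⟩ := hn
  have h2 : ‖(2 : ℤ_[2])‖ = 2⁻¹ := by simpa using PadicInt.norm_p (p := 2)
  rw [hc, norm_mul, norm_mul, norm_pow, h2]
  have := PadicInt.norm_le_one c
  have h4 : (0 : ℝ) ≤ 2⁻¹ ^ k := by positivity
  nlinarith [norm_nonneg c, mul_nonneg h4 (norm_nonneg c), mul_le_mul_of_nonneg_left this h4]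

/-- Distinct disks are at distance 1, so only times divisible by 3 can come close to the target;
distance below 1/4 means ‖2(x - y)‖ < 1/4, that is, 4 ∣ x - y. -/
lemma ActsCyclically.exists_iterate_dvd {T : OnePoint ℚ_[2] → OnePoint ℚ_[2]}
    {F : Fin 3 → ℤ_[2] → ℤ_[2]} (h : ActsCyclically T F) (hT : IsMinimalSystem T) (y : ℤ_[2]) :
    ∃ n, 4 ∣ (returnMap F)^[n] 0 - y := by
  obtain ⟨k, hk⟩ := hT (chart 0 0) (chart 0 y) (1 / 4) (by norm_num)
  refine ⟨k / 3, ?_⟩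
  rw [← Nat.mod_add_div k 3, Function.iterate_add_apply, h.iterate_chart_zero] at hk
  have hr : k % 3 < 3 := Nat.mod_lt _ (by norm_num)
  generalize k / 3 = n at *
  generalize k % 3 = r at *
  interval_cases r
  · simp only [Function.iterate_zero, id] at hk
    have h2 : ‖(2 : ℤ_[2])‖ = 2⁻¹ := by simpa using PadicInt.norm_p (p := 2)
    rw [sphericalDist_chart, norm_mul, h2] at hk
    have h1 : ‖(returnMap F)^[n] 0 - y‖ < (2 : ℕ) ^ (-1 : ℤ) := by
      norm_num; linarith
    rw [PadicInt.norm_lt_pow_iff_norm_le_pow_sub_one] at h1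
    have := (PadicInt.norm_le_pow_iff_mem_span_pow ((returnMap F)^[n] 0 - y) 2).1 (by simpa using h1)
    rw [Ideal.mem_span_singleton] at this
    norm_num at this
    exact this
  · exfalso
    simp only [Function.iterate_one] at hk
    rw [h, sphericalDist_chart_of_ne (by decide)] at hk
    norm_num at hk
  · exfalso
    simp only [Function.iterate_succ, Function.iterate_zero, Function.comp, id] at hk
    rw [h, h, sphericalDist_chart_of_ne (by decide)] at hk
    norm_num at hk

/-! ### The rational map in coordinates. -/

/-- Cross-multiplication gives the reduced numerator and denominator equal degrees, hence degree d
each; a monic divisor of g of degree d is g. -/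
lemma ratQuot_num_denom {K : Type*} [Field K] {f g : K[X]} {d : ℕ} (hf : f.Monic)
    (hg : g.Monic) (hfd : f.natDegree = d) (hgd : g.natDegree = d)
    (h : ratDegree (ratQuot f g) = d) : (ratQuot f g).num = f ∧ (ratQuot f g).denom = g := by
  have hcross : (ratQuot f g).num * g = f * (ratQuot f g).denom :=
    (RatFunc.num_mul_eq_mul_denom_iff hg.ne_zero).2 rfl
  have hdvd : (ratQuot f g).denom ∣ g := RatFunc.denom_div_dvd f g
  rw [ratDegree] at h
  have hd0 : (ratQuot f g).denom ≠ 0 := RatFunc.denom_ne_zero _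
  have hn0 : (ratQuot f g).num ≠ 0 := by
    intro h0
    rw [h0, zero_mul] at hcross
    exact mul_ne_zero hf.ne_zero hd0 hcross.symm
  have hdeg := congrArg natDegree hcross
  rw [natDegree_mul hn0 hg.ne_zero, natDegree_mul hf.ne_zero hd0] at hdeg
  have hden : (ratQuot f g).denom = g :=
    (eq_of_monic_of_dvd_of_natDegree_le (RatFunc.monic_denom _) hg hdvd (by omega)).symm
  refine ⟨?_, hden⟩
  rw [hden] at hcross
  exact mul_right_cancel₀ hg.ne_zero hcross

section

variable {φ : RatFunc ℚ_[2]} {f g : ℤ_[2][X]} {d : ℕ}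

lemma coe_eval_eq (f : ℤ_[2][X]) (z : ℤ_[2]) :
    (f.map PadicInt.Coe.ringHom).eval (z : ℚ_[2]) = ((f.eval z : ℤ_[2]) : ℚ_[2]) := by
  exact eval_map_apply (PadicInt.Coe.ringHom) z

lemma ratMap_projPt_one (hnum : φ.num = f.map PadicInt.Coe.ringHom)
    (hden : φ.denom = g.map PadicInt.Coe.ringHom) (z : ℤ_[2]) :
    ratMap φ (projPt z 1) = projPt (f.eval z) (g.eval z) := by
  rw [projPt_one]
  by_cases h : g.eval z = 0
  · rw [h, projPt_zero]
    exact if_pos (by rw [hden, coe_eval_eq, h, PadicInt.coe_zero])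
  · rw [projPt_of_ne _ h, ← coe_eval_eq, ← coe_eval_eq, ← hnum, ← hden]
    exact if_neg (by rwa [hden, coe_eval_eq, PadicInt.coe_eq_zero])

lemma eval_inv_eq (f : ℤ_[2][X]) {w : ℤ_[2]} (hw : (w : ℚ_[2]) ≠ 0) :
    (f.map PadicInt.Coe.ringHom).eval (w : ℚ_[2])⁻¹ =
      ((f.reverse.eval w : ℤ_[2]) : ℚ_[2]) * (w : ℚ_[2])⁻¹ ^ f.natDegree := by
  let _ : Invertible (w : ℚ_[2])⁻¹ := invertibleOfNonzero (inv_ne_zero hw)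
  have := eval₂_reverse_mul_pow PadicInt.Coe.ringHom (w : ℚ_[2])⁻¹ f
  rw [eval_map, ← this, invOf_eq_inv, inv_inv, ← eval_map, coe_eval_eq]

lemma ratMap_projPt_one_left (hf : f.Monic) (hg : g.Monic) (hfd : f.natDegree = d)
    (hgd : g.natDegree = d) (hnum : φ.num = f.map PadicInt.Coe.ringHom)
    (hden : φ.denom = g.map PadicInt.Coe.ringHom) (hφ : ratDegree φ = d) (w : ℤ_[2]) :
    ratMap φ (projPt 1 w) = projPt (f.reverse.eval w) (g.reverse.eval w) := by
  by_cases hw : w = 0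
  · rw [hw, projPt_zero, ← coeff_zero_eq_eval_zero, ← coeff_zero_eq_eval_zero,
      coeff_zero_reverse, coeff_zero_reverse, hf.leadingCoeff, hg.leadingCoeff, projPt_one]
    have h1 : f.coeff d = 1 := by rw [← hfd]; exact hf
    have h2 : g.coeff d = 1 := by rw [← hgd]; exact hg
    simp [ratMap, hnum, hden, hφ, h1, h2]
  · have hw' : (w : ℚ_[2]) ≠ 0 := by rwa [Ne, PadicInt.coe_eq_zero]
    rw [projPt_of_ne _ hw, PadicInt.coe_one, one_div]
    have hwd : (w : ℚ_[2])⁻¹ ^ d ≠ 0 := pow_ne_zero _ (inv_ne_zero hw')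
    have hn := eval_inv_eq f hw'
    have hd := eval_inv_eq g hw'
    rw [← hnum, hfd] at hn
    rw [← hden, hgd] at hd
    by_cases h : g.reverse.eval w = 0
    · rw [h, projPt_zero]
      exact if_pos (by rw [hd, h, PadicInt.coe_zero, zero_mul])
    · rw [projPt_of_ne _ h, ← mul_div_mul_right _ _ hwd, ← hn, ← hd]
      exact if_neg (by
        rw [hd]; exact mul_ne_zero (by rwa [Ne, PadicInt.coe_eq_zero]) hwd)

/-- The three fractions express φ in the charts: 1/φ(2x) = 2 F₀(x), φ(1/(2x)) = 1 + 2 F₁(x) in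
reversed polynomials, and φ(1 + 2x) = 2 F₂(x) by Taylor expansion at 1. -/
lemma exists_actsCyclically (hf : f.Monic) (hg : g.Monic) (hfd : f.natDegree = d)
    (hgd : g.natDegree = d) (hnum : φ.num = f.map PadicInt.Coe.ringHom)
    (hden : φ.denom = g.map PadicInt.Coe.ringHom) (hφ : ratDegree φ = d)
    (hf0 : IsUnit (f.coeff 0)) (hg0 : g.coeff 0 = 0) (hf1 : 2 ∣ f.eval 1)
    (hg1 : IsUnit (g.eval 1)) :
    ∃ F, ActsCyclically (ratMap φ) F ∧ IsHalfQuot g f (F 0) ∧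
      IsHalfQuot (f.reverse - g.reverse) g.reverse (F 1) ∧
      IsHalfQuot (taylor 1 f) (taylor 1 g) (F 2) := by
  have hfr : f.reverse.coeff 0 = 1 := by rw [coeff_zero_reverse, hf.leadingCoeff]
  have hgr : g.reverse.coeff 0 = 1 := by rw [coeff_zero_reverse, hg.leadingCoeff]
  have hgr' : IsUnit (g.reverse.coeff 0) := by rw [hgr]; exact isUnit_one
  have hgt : IsUnit ((taylor 1 g).coeff 0) := by rwa [taylor_coeff_zero]
  obtain ⟨F0, h0⟩ := exists_isHalfQuot hf0 (N := g) (by rw [hg0]; exact dvd_zero _)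
  obtain ⟨F1, h1⟩ := exists_isHalfQuot hgr' (N := f.reverse - g.reverse)
    (by rw [coeff_sub, hfr, hgr, sub_self]; exact dvd_zero _)
  obtain ⟨F2, h2⟩ := exists_isHalfQuot hgt (N := taylor 1 f) (by rwa [taylor_coeff_zero])
  refine ⟨![F0, F1, F2], fun i x => ?_, h0, h1, h2⟩
  fin_cases i
  · change ratMap φ (projPt (2 * x) 1) = projPt 1 (2 * F0 x)
    rw [ratMap_projPt_one hnum hden, ← projPt_mul_left (isUnit_eval_two_mul hf0 x).ne_zero 1,
      mul_one, ← h0 x, mul_comm (eval _ f)]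
  · change ratMap φ (projPt 1 (2 * x)) = projPt (1 + 2 * F1 x) 1
    rw [ratMap_projPt_one_left hf hg hfd hgd hnum hden hφ,
      ← projPt_mul_left (isUnit_eval_two_mul hgr' x).ne_zero (1 + _), mul_one]
    have := h1 x
    rw [eval_sub] at this
    congr 1
    linear_combination -this
  · change ratMap φ (projPt (1 + 2 * x) 1) = projPt (2 * F2 x) 1
    have := h2 x
    rw [taylor_eval, taylor_eval, add_comm] at this
    have hne := (isUnit_eval_two_mul hgt x).ne_zero
    rw [taylor_eval, add_comm] at hne
    rw [ratMap_projPt_one hnum hden, ← projPt_mul_left hne (2 * _), mul_one, ← this,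
      mul_comm (eval _ g)]

/-- If numerator and denominator are both odd at `1`, or only the numerator is, then the residue
disk of `0` is not reached from the residue disk of `∞`. -/
lemma two_dvd_eval_one_of_isMinimalSystem (hf : f.Monic) (hg : g.Monic) (hfd : f.natDegree = d)
    (hgd : g.natDegree = d) (hnum : φ.num = f.map PadicInt.Coe.ringHom)
    (hden : φ.denom = g.map PadicInt.Coe.ringHom) (hφ : ratDegree φ = d)
    (hmin : IsMinimalSystem (ratMap φ)) : 2 ∣ f.eval 1 := by
  rw [two_dvd_iff_not_isUnit]
  intro hu
  have hfr : IsUnit (f.reverse.coeff 0) := by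
    rw [coeff_zero_reverse, hf.leadingCoeff]; exact isUnit_one
  have hft : IsUnit ((taylor 1 f).coeff 0) := by rwa [taylor_coeff_zero]
  -- The union of the residue disks of ∞ and 1: every point of it is at distance 1 from 0.
  let S : Set (OnePoint ℚ_[2]) := {P | ∃ x y, IsUnit x ∧ P = projPt x y}
  have hS : ∀ P ∈ S, ratMap φ P ∈ S := by
    rintro P ⟨x, y, hx, rfl⟩
    obtain ⟨u, rfl⟩ := hx
    have : projPt u y = projPt 1 ((u⁻¹ : ℤ_[2]ˣ) * y) := by
      rw [← projPt_mul_left u.ne_zero 1, mul_one, Units.mul_inv_cancel_left]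
    rw [this]
    rcases two_dvd_or_exists_eq_one_add ((u⁻¹ : ℤ_[2]ˣ) * y) with ⟨e, he⟩ | h1
    · rw [he, ratMap_projPt_one_left hf hg hfd hgd hnum hden hφ]
      exact ⟨_, _, isUnit_eval_two_mul hfr e, rfl⟩
    · rw [← isUnit_iff_exists_eq_one_add] at h1
      obtain ⟨v, hv⟩ := h1
      obtain ⟨e, he⟩ := isUnit_iff_exists_eq_one_add.1 (v⁻¹).isUnit
      rw [← hv, ← projPt_mul_left (v⁻¹).ne_zero, Units.inv_mul, mul_one,
        ratMap_projPt_one hnum hden]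
      have := isUnit_eval_two_mul hft e
      rw [taylor_eval, add_comm, ← he] at this
      exact ⟨_, _, this, rfl⟩
  have hit : ∀ k, (ratMap φ)^[k] (projPt 1 0) ∈ S := fun k => by
    induction k with
    | zero => exact ⟨1, 0, isUnit_one, rfl⟩
    | succ k ih => rw [Function.iterate_succ_apply']; exact hS _ ih
  obtain ⟨k, hk⟩ := hmin (projPt 1 0) (projPt 0 1) 1 one_pos
  obtain ⟨x, y, hx, h⟩ := hit k
  rw [h, sphericalDist_projPt (Or.inl hx) (Or.inr isUnit_one), mul_one, zero_mul, sub_zero,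
    PadicInt.isUnit_iff.1 hx] at hk
  exact lt_irrefl _ hk

end

/-! ### Computation of the multiplier modulo 4. -/

section Arithmetic

variable {R : Type*} [CommRing R]

/-- When 4 = 0, the equation 2x = 2 plays the role of "x is odd": odd factors may be dropped from
any term that carries a factor 2. -/
lemma mul_eq_two_of_odd {x y : R} (hx : 2 * x = 2) (hy : 2 * y = 2) : 2 * (x * y) = 2 := by
  linear_combination y * hx + hy

/-- Modulo `4`, the multiplier of a composition is the product of the multipliers. -/
lemma multiplier_comp {α₀ α₁ α₂ β₀ β₁ β₂ : R} (h4 : (4 : R) = 0) (h₀ : 2 * α₀ = 2)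
    (h₁ : 2 * α₁ = 2) :
    α₀ * α₁ * α₂ + 2 * ((β₀ * α₁ + β₁ * α₀ ^ 2) * α₂ + β₂ * (α₀ * α₁) ^ 2) =
      (α₀ + 2 * β₀) * (α₁ + 2 * β₁) * (α₂ + 2 * β₂) := by
  linear_combination (β₁ * α₀ * α₂ + β₂ * α₀ * α₁ ^ 2) * h₀ + β₂ * α₀ * α₁ * h₁ -
    (α₀ * β₁ * β₂ + α₁ * β₀ * β₂ + α₂ * β₀ * β₁ + 2 * β₀ * β₁ * β₂) * h4

/-- The multiplier of the return map, modulo `4`, in terms of the coefficients. -/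
lemma multiplier_eq {a₀ a₁ b₁ b₂ r q s A A' A'' B B' B'' S T α₀ α₁ α₂ β₀ β₁ β₂ : R}
    (h4 : (4 : R) = 0) (ha₀ : 2 * a₀ = 2) (hb₁ : 2 * b₁ = 2) (hr : 2 * r = 2) (hB : 2 * B = 2)
    (hST : 2 * (S + T) = 2) (hA : A = 2) (hA' : A' + 2 * A'' = S + T)
    (hα₀ : α₀ = b₁ * a₀) (hβ₀ : β₀ = b₂ * a₀ + a₀ * a₁ * α₀) (hα₁ : α₁ = r)
    (hβ₁ : β₁ = q + s * r) (hα₂ : α₂ = A' * B - A * B')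
    (hβ₂ : β₂ = A'' * B - A * B'' + B * B' * α₂) :
    α₀ * α₁ * α₂ + 2 * ((β₀ * α₁ + β₁ * α₀ ^ 2) * α₂ + β₂ * (α₀ * α₁) ^ 2) =
      a₀ * b₁ * r * (S - T) * B + 2 * (b₂ - a₁ + q + s + T) := by
  have hα₀' : 2 * α₀ = 2 := by rw [hα₀]; exact mul_eq_two_of_odd hb₁ ha₀
  have hα₁' : 2 * α₁ = 2 := by rw [hα₁, hr]
  have hA'2 : 2 * A' = 2 := by linear_combination 2 * hA' + hST - A'' * h4
  have e₀ : α₀ + 2 * β₀ = a₀ * b₁ + 2 * (b₂ - a₁) := by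
    rw [hβ₀, hα₀]
    linear_combination (b₂ + a₁ * b₁ * a₀ + a₁ * b₁) * ha₀ + a₁ * hb₁ + a₁ * h4
  have e₁ : α₁ + 2 * β₁ = r + 2 * (q + s) := by
    rw [hβ₁, hα₁]
    linear_combination s * hr
  have e₂ : α₂ + 2 * β₂ = B * (S + T) := by
    rw [hβ₂, hα₂, hA, ← hA']
    linear_combination B' * B ^ 2 * hA'2 + (B' * B + B') * hB - (B'' + B * B' ^ 2) * h4
  have h₁ : 2 * (r * (B * (S + T))) = 2 := mul_eq_two_of_odd hr (mul_eq_two_of_odd hB hST)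
  have h₂ : 2 * (a₀ * b₁ * (B * (S + T))) = 2 :=
    mul_eq_two_of_odd (mul_eq_two_of_odd ha₀ hb₁) (mul_eq_two_of_odd hB hST)
  have h₃ : 2 * (a₀ * b₁ * r * B) = 2 :=
    mul_eq_two_of_odd (mul_eq_two_of_odd (mul_eq_two_of_odd ha₀ hb₁) hr) hB
  rw [multiplier_comp h4 hα₀' hα₁', e₀, e₁, e₂]
  linear_combination (b₂ - a₁) * h₁ + (q + s) * h₂ + T * h₃ +
    (b₂ - a₁) * (q + s) * (B * (S + T)) * h4

end Arithmetic

/-! ### Congruences, and polynomials given by their coefficients. -/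

lemma congMod_coe_iff (m : ℕ) (x y : ℤ_[2]) :
    CongMod m (x : ℚ_[2]) (y : ℚ_[2]) ↔ (m : ℤ_[2]) ∣ x - y := by
  refine exists_congr fun t => ?_
  rw [← PadicInt.coe_natCast, ← PadicInt.coe_sub, ← PadicInt.coe_mul]
  exact Subtype.coe_injective.eq_iff

lemma two_dvd_sub_one_iff {x : ℤ_[2]} : 2 ∣ x - 1 ↔ IsUnit x := by
  rw [isUnit_iff_exists_eq_one_add]
  exact exists_congr fun e => sub_eq_iff_eq_add'

/-- The polynomial with coefficients `c 0, …, c d`. -/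
def polyOfCoeffs {R : Type*} [Semiring R] (d : ℕ) (c : ℕ → R) : R[X] :=
  ∑ i ∈ Finset.range (d + 1), C (c i) * X ^ i

section polyOfCoeffs

variable {R : Type*} [CommRing R] {d : ℕ} {c : ℕ → R}

lemma coeff_polyOfCoeffs {i : ℕ} (hi : i ≤ d) : (polyOfCoeffs d c).coeff i = c i := by
  simp [polyOfCoeffs, coeff_C_mul, coeff_X_pow, Nat.lt_succ_of_le hi]

lemma natDegree_polyOfCoeffs_le : (polyOfCoeffs d c).natDegree ≤ d := by
  refine natDegree_sum_le_of_forall_le _ _ fun i hi => ?_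
  exact (natDegree_C_mul_X_pow_le _ _).trans (Nat.lt_succ_iff.1 (Finset.mem_range.1 hi))

lemma monic_polyOfCoeffs (hc : c d = 1) : (polyOfCoeffs d c).Monic :=
  monic_of_natDegree_le_of_coeff_eq_one d natDegree_polyOfCoeffs_le
    (by rw [coeff_polyOfCoeffs le_rfl, hc])

lemma natDegree_polyOfCoeffs [Nontrivial R] (hc : c d = 1) :
    (polyOfCoeffs d c).natDegree = d :=
  natDegree_eq_of_le_of_coeff_ne_zero natDegree_polyOfCoeffs_le
    (by rw [coeff_polyOfCoeffs le_rfl, hc]; exact one_ne_zero)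

lemma map_polyOfCoeffs {S : Type*} [CommRing S] (i : R →+* S) :
    (polyOfCoeffs d c).map i = polyOfCoeffs d (fun n => i (c n)) := by
  simp [polyOfCoeffs, Polynomial.map_sum]

lemma coeff_reverse_polyOfCoeffs [Nontrivial R] (hc : c d = 1) {i : ℕ} (hi : i ≤ d) :
    (polyOfCoeffs d c).reverse.coeff i = c (d - i) := by
  rw [coeff_reverse, natDegree_polyOfCoeffs hc, revAt_le hi, coeff_polyOfCoeffs (Nat.sub_le _ _)]

lemma eval_one_polyOfCoeffs :
    (polyOfCoeffs d c).eval 1 = ∑ i ∈ Finset.range (d + 1), c i := by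
  simp [polyOfCoeffs, eval_finsetSum]

lemma coeff_taylor_polyOfCoeffs (n : ℕ) :
    (taylor 1 (polyOfCoeffs d c)).coeff n =
      ∑ i ∈ Finset.range (d + 1), c i * (i.choose n : R) := by
  simp [polyOfCoeffs, map_sum, coeff_C_mul, coeff_X_add_one_pow, taylor_mul]

/-- Modulo `4`, `i + 2 * choose i 2 = i ^ 2` is the indicator of the odd numbers. -/
lemma four_dvd_coeff_taylor_add :
    4 ∣ (taylor 1 (polyOfCoeffs d c)).coeff 1 + 2 * (taylor 1 (polyOfCoeffs d c)).coeff 2 -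
      ∑ i ∈ Finset.range (d + 1) with i % 2 = 1, c i := by
  rw [coeff_taylor_polyOfCoeffs, coeff_taylor_polyOfCoeffs, Finset.mul_sum,
    ← Finset.sum_add_distrib, Finset.sum_filter, ← Finset.sum_sub_distrib]
  refine Finset.dvd_sum fun i _ => ?_
  have h : (i : ℤ) + 2 * (i.choose 2 : ℕ) = i ^ 2 := by
    rcases i with - | i
    · simp
    · have h1 : (i + 1).choose 2 * 2 = (i + 1) * i := by
        rw [Nat.choose_two_right, Nat.add_sub_cancel]
        exact Nat.div_mul_cancel (by simpa [mul_comm] using (Nat.even_mul_succ_self i).two_dvd)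
      zify at h1
      push_cast
      linear_combination h1
  have h' : (i : R) + 2 * (i.choose 2 : ℕ) = i ^ 2 := by
    exact_mod_cast congrArg (Int.cast (R := R)) h
  rw [Nat.choose_one_right]
  split_ifs with hi
  · obtain ⟨k, rfl⟩ : ∃ k, i = 2 * k + 1 := ⟨i / 2, by omega⟩
    refine ⟨c (2 * k + 1) * (k ^ 2 + k), ?_⟩
    push_cast at h' ⊢
    linear_combination c (2 * k + 1) * h'
  · obtain ⟨k, rfl⟩ : ∃ k, i = 2 * k := ⟨i / 2, by omega⟩
    refine ⟨c (2 * k) * k ^ 2, ?_⟩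
    push_cast at h' ⊢
    linear_combination c (2 * k) * h'

end polyOfCoeffs

lemma two_mul_map_of_isUnit {R : Type*} [CommRing R] (h4 : (4 : R) = 0) (π : ℤ_[2] →+* R)
    {x : ℤ_[2]} (hx : IsUnit x) : 2 * π x = 2 := by
  obtain ⟨e, rfl⟩ := isUnit_iff_exists_eq_one_add.1 hx
  rw [map_add, map_mul, map_one, map_ofNat]
  linear_combination π e * h4

lemma isUnit_iff_of_two_dvd_sub {x y : ℤ_[2]} (h : 2 ∣ x - y) : IsUnit x ↔ IsUnit y := by
  rw [← not_iff_not, ← two_dvd_iff_not_isUnit, ← two_dvd_iff_not_isUnit]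
  exact ⟨fun hx => by simpa using dvd_sub hx h, fun hy => by simpa using dvd_add h hy⟩

lemma isUnit_of_four_dvd {x y : ℤ_[2]} (h : 4 ∣ x + 2 * y - 1) : IsUnit x := by
  obtain ⟨t, ht⟩ := h
  exact (isUnit_iff_of_two_dvd_sub ⟨2 * t - y, by linear_combination ht⟩).2 isUnit_one

/-! ### The first return map in terms of the coefficients. -/

/-- The conditions on integral coefficients which determine the first return map to the residue
disk of `0` up to the required accuracy. -/
def ReturnCondition (d : ℕ) (a b : ℕ → ℤ_[2]) : Prop :=
  4 ∣ ∑ i ∈ Finset.range (d + 1), a i - 2 ∧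
  IsUnit (∑ i ∈ Finset.range (d + 1) with i % 2 = 1, a i) ∧
  IsUnit (b 1) ∧
  IsUnit (a (d - 1) - b (d - 1)) ∧
  4 ∣ a 0 * b 1 * (a (d - 1) - b (d - 1)) *
      (∑ i ∈ Finset.range (d + 1) with i % 4 = 1, a i -
        ∑ i ∈ Finset.range (d + 1) with i % 4 = 3, a i) * ∑ i ∈ Finset.range (d + 1), b i +
    2 * (b 2 - a 1 + a (d - 2) - b (d - 2) + b (d - 1) +
      ∑ i ∈ Finset.range (d + 1) with i % 4 = 3, a i) - 1

lemma sum_filter_odd {M : Type*} [AddCommMonoid M] (s : Finset ℕ) (a : ℕ → M) :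
    ∑ i ∈ s with i % 2 = 1, a i = ∑ i ∈ s with i % 4 = 1, a i + ∑ i ∈ s with i % 4 = 3, a i := by
  rw [← Finset.sum_union]
  · congr 1
    ext i
    simp only [Finset.mem_filter, Finset.mem_union]
    grind
  · rw [Finset.disjoint_filter]
    intro i _ h1 h3
    omega

/-- The first two transitions fix the parameter 0, so the return map sends 0 to A/(2B), which is odd
exactly when A ≡ 2 mod 4. The linear coefficients of the transitions are b_1 a_0, a_(d-1) - b_(d-1),
and a number with the parity of the sum of the a_i over odd i. -/
lemma exists_quadApprox_returnMap {d : ℕ} (hd : 2 ≤ d) {a b : ℕ → ℤ_[2]} (ha : a d = 1)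
    (hb : b d = 1) (hb0 : b 0 = 0) (ha0 : IsUnit (a 0))
    (hB : IsUnit (∑ i ∈ Finset.range (d + 1), b i)) {F : Fin 3 → ℤ_[2] → ℤ_[2]}
    (h0 : IsHalfQuot (polyOfCoeffs d b) (polyOfCoeffs d a) (F 0))
    (h1 : IsHalfQuot ((polyOfCoeffs d a).reverse - (polyOfCoeffs d b).reverse)
      (polyOfCoeffs d b).reverse (F 1))
    (h2 : IsHalfQuot (taylor 1 (polyOfCoeffs d a)) (taylor 1 (polyOfCoeffs d b)) (F 2)) :
    ∃ α β : ℤ_[2], QuadApprox (returnMap F) α β ∧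
      ((IsUnit (returnMap F 0) ∧ 4 ∣ α + 2 * β - 1) ↔ ReturnCondition d a b) ∧
      (ReturnCondition d a b → ∀ i x y, ‖F i x - F i y‖ = ‖x - y‖) := by
  have c0 : (polyOfCoeffs d a).coeff 0 = a 0 := coeff_polyOfCoeffs (by omega)
  have c1 : (polyOfCoeffs d a).coeff 1 = a 1 := coeff_polyOfCoeffs (by omega)
  have c0' : (polyOfCoeffs d b).coeff 0 = 0 := by rw [coeff_polyOfCoeffs (by omega), hb0]
  have c1' : (polyOfCoeffs d b).coeff 1 = b 1 := coeff_polyOfCoeffs (by omega)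
  have c2' : (polyOfCoeffs d b).coeff 2 = b 2 := coeff_polyOfCoeffs (by omega)
  have r0 : (polyOfCoeffs d a).reverse.coeff 0 = 1 := by
    rw [coeff_reverse_polyOfCoeffs ha (by omega), Nat.sub_zero, ha]
  have r0' : (polyOfCoeffs d b).reverse.coeff 0 = 1 := by
    rw [coeff_reverse_polyOfCoeffs hb (by omega), Nat.sub_zero, hb]
  have t0 : (taylor 1 (polyOfCoeffs d a)).coeff 0 = ∑ i ∈ Finset.range (d + 1), a i := by
    rw [taylor_coeff_zero, eval_one_polyOfCoeffs]
  have t0' : (taylor 1 (polyOfCoeffs d b)).coeff 0 = ∑ i ∈ Finset.range (d + 1), b i := by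
    rw [taylor_coeff_zero, eval_one_polyOfCoeffs]
  have q0 := h0.quadApprox (by rwa [c0])
  have q1 := h1.quadApprox (by rw [r0']; exact isUnit_one)
  have q2 := h2.quadApprox (by rwa [t0'])
  have z0 : F 0 0 = 0 := by
    have := h0 0
    rw [mul_zero, ← coeff_zero_eq_eval_zero, ← coeff_zero_eq_eval_zero, c0, c0', mul_assoc] at this
    simpa [ha0.ne_zero] using this
  have z1 : F 1 0 = 0 := by
    have := h1 0
    rw [mul_zero, ← coeff_zero_eq_eval_zero, ← coeff_zero_eq_eval_zero, coeff_sub, r0, r0'] at this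
    simpa using this
  have z2 : 2 * F 2 0 * ∑ i ∈ Finset.range (d + 1), b i = ∑ i ∈ Finset.range (d + 1), a i := by
    have := h2 0
    rwa [mul_zero, ← coeff_zero_eq_eval_zero, ← coeff_zero_eq_eval_zero, t0, t0'] at this
  have hret : returnMap F 0 = F 2 0 := by simp only [returnMap, Function.comp, z0, z1]
  obtain ⟨m, hm⟩ := four_dvd_coeff_taylor_add (c := a) (d := d)
  rw [coeff_sub, coeff_sub, coeff_sub, r0, r0',
    coeff_reverse_polyOfCoeffs ha (by omega), coeff_reverse_polyOfCoeffs hb (by omega),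
    coeff_reverse_polyOfCoeffs ha (by omega), coeff_reverse_polyOfCoeffs hb (by omega)] at q1
  rw [c0, c0', c1, c1', c2'] at q0
  rw [t0, t0'] at q2
  simp only [zero_mul, sub_zero, mul_one, one_mul, sub_self] at q0 q1
  rw [sum_filter_odd] at hm
  rw [ReturnCondition, sum_filter_odd, hret]
  generalize (taylor 1 (polyOfCoeffs d a)).coeff 1 = A' at *
  generalize (taylor 1 (polyOfCoeffs d a)).coeff 2 = A'' at *
  generalize (taylor 1 (polyOfCoeffs d b)).coeff 1 = B' at *
  generalize (taylor 1 (polyOfCoeffs d b)).coeff 2 = B'' at *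
  generalize ∑ i ∈ Finset.range (d + 1), a i = A at *
  generalize ∑ i ∈ Finset.range (d + 1), b i = B at *
  generalize ∑ i ∈ Finset.range (d + 1) with i % 4 = 1, a i = S at *
  generalize ∑ i ∈ Finset.range (d + 1) with i % 4 = 3, a i = T at *
  have hA : IsUnit (F 2 0) ↔ 4 ∣ A - 2 := by
    obtain ⟨e, he⟩ := isUnit_iff_exists_eq_one_add.1 hB
    rw [← z2, ← two_dvd_sub_one_iff]
    constructor
    · rintro ⟨t, ht⟩
      exact ⟨t + F 2 0 * e, by rw [he]; linear_combination 2 * ht⟩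
    · rintro ⟨t, ht⟩
      refine ⟨t - F 2 0 * e, mul_left_cancel₀ (two_ne_zero (α := ℤ_[2])) ?_⟩
      rw [he] at ht
      linear_combination ht
  have hα₀ : IsUnit (b 1 * a 0) ↔ IsUnit (b 1) := by simp [IsUnit.mul_iff, ha0]
  have hα₂ : IsUnit (A' * B - A * B') ↔ IsUnit (S + T) := by
    have : IsUnit (A' * B) ↔ IsUnit A' := by simp [IsUnit.mul_iff, hB]
    rw [isUnit_iff_of_two_dvd_sub (y := A' * B) ⟨-(F 2 0 * B * B'), by rw [← z2]; ring⟩, this]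
    exact isUnit_iff_of_two_dvd_sub ⟨2 * m - A'', by linear_combination hm⟩
  let π : ℤ_[2] →+* ZMod (2 ^ 2) := PadicInt.toZModPow 2
  have hπ : ∀ x, 4 ∣ x ↔ π x = 0 := fun x => by
    rw [← RingHom.mem_ker, PadicInt.ker_toZModPow, Ideal.mem_span_singleton]
    norm_num
  have h4 : (4 : ZMod (2 ^ 2)) = 0 := rfl
  have hu : ∀ {x}, IsUnit x → 2 * π x = 2 := fun hx => two_mul_map_of_isUnit h4 π hx
  refine ⟨_, _, q2.comp (q1.comp q0), ?_, ?_⟩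
  · rw [hA]
    refine and_congr_right fun h2 => ?_
    have key : IsUnit (S + T) → IsUnit (b 1) → IsUnit (a (d - 1) - b (d - 1)) → _ :=
      fun hST hb1 hr => multiplier_eq (A'' := π A'') (B'' := π B'') (a₁ := π (a 1))
        (b₂ := π (b 2)) (q := π (a (d - 2) - b (d - 2))) (s := π (b (d - 1)))
        (A' := π A') (B' := π B') (S := π S) (T := π T)
        h4 (hu ha0) (hu hb1) (hu hr) (hu hB) (by rw [← map_add]; exact hu hST)
        (A := π A) (by rw [hπ, map_sub, map_ofNat, sub_eq_zero] at h2; exact h2)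
        (by
          have := congrArg π hm
          simp only [map_sub, map_add, map_mul, map_ofNat, h4, zero_mul, sub_eq_zero] at this
          exact this)
        rfl rfl rfl rfl rfl rfl
    constructor
    · intro h
      -- A linear coefficient of the return map that is odd has odd factors; only then does the
      -- multiplier formula apply.
      have hunit := isUnit_of_four_dvd h
      rw [IsUnit.mul_iff, IsUnit.mul_iff, hα₀, hα₂] at hunit
      obtain ⟨⟨hb1, hr⟩, hST⟩ := hunit
      refine ⟨hST, hb1, hr, ?_⟩
      have key := key hST hb1 hr
      rw [hπ, map_sub, sub_eq_zero] at h ⊢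
      simp only [map_add, map_sub, map_mul, map_pow, map_ofNat, map_one] at key h ⊢
      linear_combination h - key
    · rintro ⟨hST, hb1, hr, h⟩
      have key := key hST hb1 hr
      rw [hπ, map_sub, sub_eq_zero] at h ⊢
      simp only [map_add, map_sub, map_mul, map_pow, map_ofNat, map_one] at key h ⊢
      linear_combination h + key
  · rintro ⟨-, hST, hb1, hr, -⟩ i
    fin_cases i
    exacts [q0.norm_sub (hα₀.2 hb1), q1.norm_sub hr, q2.norm_sub (hα₂.2 hST)]

/-! ### Good reduction and the translation of the coefficient conditions. -/

lemma ratDegree_ratQuot_le {K : Type*} [Field K] (p q : K[X]) :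
    ratDegree (ratQuot p q) ≤ max p.natDegree q.natDegree := by
  by_cases hq : q = 0
  · simp [ratQuot, ratDegree, hq]
  by_cases hp : p = 0
  · simp [ratQuot, ratDegree, hp]
  exact max_le_max (natDegree_le_of_dvd (RatFunc.num_div_dvd p hq) hp)
    (natDegree_le_of_dvd (RatFunc.denom_div_dvd p q) hq)

lemma ratDegree_ratQuot_lt_of_common_root {K : Type*} [Field K] {p q : K[X]} {d : ℕ} {z : K}
    (hd : 0 < d) (hp : p.natDegree ≤ d) (hq : q.natDegree ≤ d) (hpz : p.IsRoot z)
    (hqz : q.IsRoot z) : ratDegree (ratQuot p q) < d := by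
  obtain ⟨p, rfl⟩ := dvd_iff_isRoot.2 hpz
  obtain ⟨q, rfl⟩ := dvd_iff_isRoot.2 hqz
  have hz : (X - C z : K[X]) ≠ 0 := X_sub_C_ne_zero z
  have hdeg : ∀ r : K[X], ((X - C z) * r).natDegree ≤ d → r.natDegree < d := fun r hr => by
    by_cases h : r = 0
    · rwa [h, natDegree_zero]
    · rw [natDegree_mul hz h, natDegree_X_sub_C] at hr
      omega
  have : ratQuot ((X - C z) * p) ((X - C z) * q) = ratQuot p q := by
    rw [ratQuot, map_mul, map_mul, mul_div_mul_left _ _ (RatFunc.algebraMap_ne_zero hz), ratQuot]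
  rw [this]
  exact (ratDegree_ratQuot_le p q).trans_lt (max_lt (hdeg p hp) (hdeg q hq))

lemma toZMod_eq_zero_iff_not_isUnit {x : ℤ_[2]} : PadicInt.toZMod x = 0 ↔ ¬ IsUnit x := by
  rw [← RingHom.mem_ker, PadicInt.ker_toZMod, IsLocalRing.mem_maximalIdeal, mem_nonunits_iff]

/-- By coprimality an integral pair is a constant multiple of the monic pair. If that constant were
not a unit, both degrees would drop modulo 2; a common zero modulo 2 would also lower the degree of
the reduction. -/
lemma HasGoodReduction.exists_unit {φ : RatFunc ℚ_[2]} (h : HasGoodReduction φ) {f g : ℚ_[2][X]}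
    {d : ℕ} (hd : 0 < d) (hf : f.Monic) (hg : g.Monic) (hfd : f.natDegree = d)
    (hgd : g.natDegree = d)
    (hnum : φ.num = f) (hden : φ.denom = g) :
    ∃ (F G : ℤ_[2][X]) (u : ℤ_[2]ˣ), F.map PadicInt.Coe.ringHom = C ((u : ℤ_[2]) : ℚ_[2]) * f ∧
      G.map PadicInt.Coe.ringHom = C ((u : ℤ_[2]) : ℚ_[2]) * g ∧
      ∀ z, IsUnit (F.eval z) ∨ IsUnit (G.eval z) := by
  obtain ⟨F, G, hG, hcop, -, hφ, hred⟩ := h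
  have hinj : Function.Injective (PadicInt.Coe.ringHom : ℤ_[2] →+* ℚ_[2]) :=
    Subtype.coe_injective
  have hG' : G.map PadicInt.Coe.ringHom ≠ 0 := (Polynomial.map_ne_zero_iff hinj).2 hG
  have hdvd : φ.num ∣ F.map PadicInt.Coe.ringHom := by
    rw [hφ]; exact RatFunc.num_div_dvd _ hG'
  have hcross : φ.num * G.map PadicInt.Coe.ringHom = F.map PadicInt.Coe.ringHom * φ.denom :=
    (RatFunc.num_mul_eq_mul_denom_iff hG').2 hφ
  rw [hnum, hden] at hcross
  rw [hnum] at hdvd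
  obtain ⟨h, hFh⟩ := hdvd
  have hGh : G.map PadicInt.Coe.ringHom = g * h := by
    apply mul_left_cancel₀ hf.ne_zero
    rw [hcross, hFh]; ring
  have hu : IsUnit h := hcop.isUnit_of_dvd' ⟨f, by rw [hFh, mul_comm]⟩ ⟨g, by rw [hGh, mul_comm]⟩
  obtain ⟨c, -, rfl⟩ := Polynomial.isUnit_iff.1 hu
  have hFd : F.natDegree ≤ d := by
    rw [← natDegree_map_eq_of_injective hinj, hFh, ← hfd]
    exact natDegree_mul_C_le _ _
  have hGd : G.natDegree ≤ d := by
    rw [← natDegree_map_eq_of_injective hinj, hGh, ← hgd]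
    exact natDegree_mul_C_le _ _
  have hdeg : ratDegree φ = d := by rw [ratDegree, hnum, hden, hfd, hgd, max_self]
  rw [hdeg] at hred
  have hcoeff : ∀ {P : ℤ_[2][X]} {p : ℚ_[2][X]}, p.Monic → p.natDegree = d →
      P.map PadicInt.Coe.ringHom = p * C c → ((P.coeff d : ℤ_[2]) : ℚ_[2]) = c := by
    intro P p hp hpd h
    have := congrArg (fun p => p.coeff d) h
    simp only [coeff_map, coeff_mul_C] at this
    rw [← hpd, hp.coeff_natDegree, hpd, one_mul] at this
    exact this
  have hFc := hcoeff hf hfd hFh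
  have hGc := hcoeff hg hgd hGh
  have hFG : G.coeff d = F.coeff d := Subtype.coe_injective (hGc.trans hFc.symm)
  have hunit : IsUnit (F.coeff d) := by
    by_contra hn
    rw [← toZMod_eq_zero_iff_not_isUnit] at hn
    have hlt : ∀ P : ℤ_[2][X], P.natDegree ≤ d → P.coeff d = F.coeff d →
        (P.map PadicInt.toZMod).natDegree < d := fun P hP hPd => by
      refine lt_of_le_of_ne (natDegree_map_le.trans hP) fun heq => ?_
      have h0 : (P.map PadicInt.toZMod).leadingCoeff = 0 := by
        rw [leadingCoeff, heq, coeff_map, hPd, hn]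
      rw [leadingCoeff_eq_zero] at h0
      rw [h0, natDegree_zero] at heq
      omega
    have := ratDegree_ratQuot_le (F.map PadicInt.toZMod) (G.map PadicInt.toZMod)
    rw [hred] at this
    exact absurd (max_lt (hlt F hFd rfl) (hlt G hGd hFG)) (not_lt.2 this)
  obtain ⟨u, hu⟩ := hunit
  rw [← hu] at hFc
  refine ⟨F, G, u, by rw [hFh, hFc, mul_comm], by rw [hGh, hFc, mul_comm], fun z => ?_⟩
  by_contra hn
  rw [not_or, ← toZMod_eq_zero_iff_not_isUnit, ← toZMod_eq_zero_iff_not_isUnit] at hn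
  have hroot : ∀ P : ℤ_[2][X], PadicInt.toZMod (P.eval z) = 0 →
      (P.map PadicInt.toZMod).IsRoot (PadicInt.toZMod z) := fun P hP => by
    rw [IsRoot, eval_map_apply, hP]
  exact absurd hred (ratDegree_ratQuot_lt_of_common_root hd (natDegree_map_le.trans hFd)
    (natDegree_map_le.trans hGd) (hroot F hn.1) (hroot G hn.2)).ne

lemma coeffCondition_iff {d : ℕ} (hd : 2 ≤ d) {a b : ℕ → ℚ_[2]} {a' b' : ℕ → ℤ_[2]}
    (ha : ∀ i ≤ d, a i = a' i) (hb : ∀ i ≤ d, b i = b' i) (hb0 : b' 0 = 0) :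
    CoeffCondition d a b ↔ IsUnit (a' 0) ∧ IsUnit (∑ i ∈ Finset.range (d + 1), b' i) ∧
      ReturnCondition d a' b' := by
  have hsum : ∀ {p : ℕ → Prop} [DecidablePred p],
      ∑ i ∈ Finset.range (d + 1) with p i, a i =
        ((∑ i ∈ Finset.range (d + 1) with p i, a' i : ℤ_[2]) : ℚ_[2]) := fun {p} _ => by
    rw [PadicInt.coe_sum]
    refine Finset.sum_congr rfl fun i hi => ha i ?_
    exact Nat.lt_succ_iff.1 (Finset.mem_range.1 (Finset.mem_filter.1 hi).1)
  have hA : sumA d a = ((∑ i ∈ Finset.range (d + 1), a' i : ℤ_[2]) : ℚ_[2]) := by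
    rw [PadicInt.coe_sum]
    exact Finset.sum_congr rfl fun i hi => ha i (Nat.lt_succ_iff.1 (Finset.mem_range.1 hi))
  have hB : sumB d b = ((∑ i ∈ Finset.range (d + 1), b' i : ℤ_[2]) : ℚ_[2]) := by
    rw [PadicInt.coe_sum, Finset.sum_range_eq_add_Ico _ (by omega), hb0, PadicInt.coe_zero,
      zero_add]
    exact Finset.sum_congr rfl fun i hi => hb i (Finset.mem_Icc.1 hi).2
  have hint : (∀ i, i ≤ d - 1 → ‖a i‖ ≤ 1) ∧ (∀ j, 1 ≤ j → j ≤ d - 1 → ‖b j‖ ≤ 1) :=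
    ⟨fun i hi => by rw [ha i (by omega)]; exact (a' i).2,
      fun i _ hi => by rw [hb i (by omega)]; exact (b' i).2⟩
  have h2 : ∀ x : ℤ_[2], CongMod 2 (x : ℚ_[2]) 1 ↔ IsUnit x := fun x => by
    rw [← PadicInt.coe_one, congMod_coe_iff, ← two_dvd_sub_one_iff]; rfl
  rw [CoeffCondition, ReturnCondition, sumA1, sumA2, sumA3, hsum, hsum, hsum, hA, hB,
    ha 0 (by omega), ha 1 (by omega), ha (d - 1) (by omega), ha (d - 2) (by omega),
    hb 1 (by omega), hb 2 (by omega), hb (d - 1) (by omega), hb (d - 2) (by omega)]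
  have h42 : ∀ x : ℤ_[2], CongMod 4 (x : ℚ_[2]) 2 ↔ 4 ∣ x - 2 := fun x => by
    exact congMod_coe_iff 4 x 2
  have h41 : ∀ x : ℤ_[2], CongMod 4 (x : ℚ_[2]) 1 ↔ 4 ∣ x - 1 := fun x => by
    exact congMod_coe_iff 4 x 1
  have h2c : (2 : ℚ_[2]) = ((2 : ℤ_[2]) : ℚ_[2]) := rfl
  rw [h2c]
  simp only [← PadicInt.coe_sub, ← PadicInt.coe_mul, ← PadicInt.coe_add]
  rw [← h2c, h2, h2, h2, h2, h2, h42, h41]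
  tauto

lemma ratOfCoeffs_eq {K : Type*} [Field K] (d : ℕ) {a b : ℕ → K} (hb0 : b 0 = 0) :
    ratOfCoeffs d a b = ratQuot (polyOfCoeffs d a) (polyOfCoeffs d b) := by
  rw [ratOfCoeffs, polyOfCoeffs, polyOfCoeffs]
  congr 1
  rw [Finset.sum_range_eq_add_Ico _ (by omega), hb0, C_0, zero_mul, zero_add]
  rfl

end PadicDyn

end

/-! ### The theorem. -/

theorem theorem1p4 (d : ℕ) (hd : 2 ≤ d) (a b : ℕ → ℚ_[2])
    (ha : a d = 1) (hb : b d = 1) (hb0 : b 0 = 0)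
    (φ : RatFunc ℚ_[2]) (hφ : φ = PadicDyn.ratOfCoeffs d a b)
    (hdeg : PadicDyn.ratDegree φ = d) :
    (PadicDyn.HasGoodReduction φ ∧ PadicDyn.IsMinimalSystem (PadicDyn.ratMap φ) →
      PadicDyn.CoeffCondition d a b) ∧
    (PadicDyn.CoeffCondition d a b →
      PadicDyn.IsOneLipschitz (PadicDyn.ratMap φ) ∧
        PadicDyn.IsMinimalSystem (PadicDyn.ratMap φ)) := by
  open PadicDyn in
  have hφ' : φ = ratQuot (polyOfCoeffs d a) (polyOfCoeffs d b) := by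
    rw [hφ, ratOfCoeffs_eq d hb0]
  obtain ⟨hnum, hden⟩ : φ.num = polyOfCoeffs d a ∧ φ.denom = polyOfCoeffs d b := by
    rw [hφ'] at hdeg ⊢
    exact ratQuot_num_denom (monic_polyOfCoeffs ha) (monic_polyOfCoeffs hb)
      (natDegree_polyOfCoeffs ha) (natDegree_polyOfCoeffs hb) hdeg
  -- The default value 0 can only occur at indices beyond d, which play no role.
  have lift : ∀ c : ℕ → ℚ_[2], (∀ i ≤ d, ‖c i‖ ≤ 1) → ∃ c' : ℕ → ℤ_[2], ∀ i ≤ d, c i = c' i :=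
    fun c hc => ⟨fun i => if h : ‖c i‖ ≤ 1 then ⟨c i, h⟩ else 0, fun i hi => by
      simp [hc i hi]⟩
  have hmap : ∀ {c : ℕ → ℚ_[2]} {c' : ℕ → ℤ_[2]}, (∀ i ≤ d, c i = c' i) →
      polyOfCoeffs d c = (polyOfCoeffs d c').map PadicInt.Coe.ringHom := fun {c c'} h => by
    rw [map_polyOfCoeffs]
    refine Finset.sum_congr rfl fun i hi => ?_
    rw [h i (Nat.lt_succ_iff.1 (Finset.mem_range.1 hi))]
    rfl
  have hone : ∀ x : ℤ_[2], (x : ℚ_[2]) = 1 → x = 1 := fun x hx => Subtype.coe_injective hx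
  have hzero : ∀ x : ℤ_[2], (x : ℚ_[2]) = 0 → x = 0 := fun x hx => Subtype.coe_injective hx
  constructor
  · rintro ⟨hgood, hmin⟩
    obtain ⟨F, G, u, hF, hG, hFG⟩ := hgood.exists_unit (by omega) (monic_polyOfCoeffs ha)
      (monic_polyOfCoeffs hb) (natDegree_polyOfCoeffs ha) (natDegree_polyOfCoeffs hb) hnum hden
    have hnorm : ∀ {P : Polynomial ℤ_[2]} {c : ℕ → ℚ_[2]},
        P.map PadicInt.Coe.ringHom = Polynomial.C ((u : ℤ_[2]) : ℚ_[2]) * polyOfCoeffs d c →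
        ∀ i ≤ d, ‖c i‖ ≤ 1 := fun {P c} h i hi => by
      have h1 := congrArg (fun p => p.coeff i) h
      simp only [Polynomial.coeff_map, Polynomial.coeff_C_mul, coeff_polyOfCoeffs hi] at h1
      have h2 : ‖((P.coeff i : ℤ_[2]) : ℚ_[2])‖ ≤ 1 := (P.coeff i).2
      change ((P.coeff i : ℤ_[2]) : ℚ_[2]) = _ at h1
      rwa [h1, norm_mul, PadicInt.padic_norm_e_of_padicInt, PadicInt.norm_units, one_mul] at h2
    obtain ⟨a', ha'⟩ := lift a (hnorm hF)
    obtain ⟨b', hb'⟩ := lift b (hnorm hG)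
    have had : a' d = 1 := hone _ (by rw [← ha' d le_rfl, ha])
    have hbd : b' d = 1 := hone _ (by rw [← hb' d le_rfl, hb])
    have hb0' : b' 0 = 0 := hzero _ (by rw [← hb' 0 (by omega), hb0])
    rw [hmap ha'] at hnum hF
    rw [hmap hb'] at hden hG
    have hinj : ∀ {P p : Polynomial ℤ_[2]}, P.map PadicInt.Coe.ringHom =
        Polynomial.C ((u : ℤ_[2]) : ℚ_[2]) * p.map PadicInt.Coe.ringHom →
        P = Polynomial.C (u : ℤ_[2]) * p := fun {P p} h => by
      apply Polynomial.map_injective (PadicInt.Coe.ringHom : ℤ_[2] →+* ℚ_[2])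
        Subtype.coe_injective
      rw [h, Polynomial.map_mul, Polynomial.map_C]
      rfl
    have hunit : ∀ z, IsUnit ((polyOfCoeffs d a').eval z) ∨ IsUnit ((polyOfCoeffs d b').eval z) :=
      fun z => by
        simpa [hinj hF, hinj hG, IsUnit.mul_iff] using hFG z
    have hma := monic_polyOfCoeffs had
    have hmb := monic_polyOfCoeffs hbd
    have hda := natDegree_polyOfCoeffs had
    have hdb := natDegree_polyOfCoeffs hbd
    have h2A := two_dvd_eval_one_of_isMinimalSystem hma hmb hda hdb hnum hden hdeg hmin
    -- Numerator and denominator are not both even at 1, nor, below, at 0, where the denominator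
    -- vanishes.
    have hB : IsUnit ((polyOfCoeffs d b').eval 1) :=
      (hunit 1).resolve_left (two_dvd_iff_not_isUnit.1 h2A)
    have hb00 : (polyOfCoeffs d b').coeff 0 = 0 := by rw [coeff_polyOfCoeffs (by omega), hb0']
    have ha0 : IsUnit ((polyOfCoeffs d a').coeff 0) := by
      rw [Polynomial.coeff_zero_eq_eval_zero]
      refine (hunit 0).resolve_right ?_
      rw [← Polynomial.coeff_zero_eq_eval_zero, hb00]
      exact not_isUnit_zero
    obtain ⟨T, hT, h0, h1, h2⟩ :=
      exists_actsCyclically hma hmb hda hdb hnum hden hdeg ha0 hb00 h2A hB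
    rw [coeff_polyOfCoeffs (by omega)] at ha0
    rw [eval_one_polyOfCoeffs] at hB
    obtain ⟨α, β, hq, hiff, -⟩ :=
      exists_quadApprox_returnMap hd had hbd hb0' ha0 hB h0 h1 h2
    rw [coeffCondition_iff hd ha' hb' hb0']
    exact ⟨ha0, hB, hiff.1 (hq.of_dense (hT.exists_iterate_dvd hmin))⟩
  · intro hcond
    have hnorm : ∀ c : ℕ → ℚ_[2], c d = 1 → (∀ i, i ≤ d - 1 → ‖c i‖ ≤ 1) → ∀ i ≤ d, ‖c i‖ ≤ 1 :=
      fun c hc h i hi => by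
        rcases hi.eq_or_lt with rfl | hi
        · rw [hc, norm_one]
        · exact h i (by omega)
    obtain ⟨a', ha'⟩ := lift a (hnorm a ha hcond.1.1)
    obtain ⟨b', hb'⟩ := lift b (hnorm b hb fun i hi => by
      rcases Nat.eq_zero_or_pos i with rfl | h0
      · rw [hb0, norm_zero]; exact zero_le_one
      · exact hcond.1.2 i h0 hi)
    have had : a' d = 1 := hone _ (by rw [← ha' d le_rfl, ha])
    have hbd : b' d = 1 := hone _ (by rw [← hb' d le_rfl, hb])
    have hb0' : b' 0 = 0 := hzero _ (by rw [← hb' 0 (by omega), hb0])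
    rw [coeffCondition_iff hd ha' hb' hb0'] at hcond
    obtain ⟨ha0, hB, hret⟩ := hcond
    rw [hmap ha'] at hnum
    rw [hmap hb'] at hden
    obtain ⟨T, hT, h0, h1, h2⟩ :=
      exists_actsCyclically (monic_polyOfCoeffs had) (monic_polyOfCoeffs hbd)
        (natDegree_polyOfCoeffs had) (natDegree_polyOfCoeffs hbd) hnum hden hdeg
        (by rwa [coeff_polyOfCoeffs (by omega)])
        (by rw [coeff_polyOfCoeffs (by omega), hb0'])
        (by
          obtain ⟨t, ht⟩ := hret.1
          rw [eval_one_polyOfCoeffs]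
          exact ⟨1 + 2 * t, by linear_combination ht⟩)
        (by rwa [eval_one_polyOfCoeffs])
    obtain ⟨α, β, hq, hiff, hiso⟩ :=
      exists_quadApprox_returnMap hd had hbd hb0' ha0 hB h0 h1 h2
    obtain ⟨hc, hm⟩ := hiff.2 hret
    exact ⟨fun P Q => (hT.sphericalDist_map (hiso hret) P Q).le,
      hT.isMinimalSystem (hiso hret) (hq.exists_iterate_dvd hc hm)⟩
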